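/- Let $p$ be prime, $\omega=e^{2\pi i/p}$, and let $\mathrm{Vec}(\mathbb Z/p)$ be the category of $\mathbb Z/p$-graded vector spaces with trivial associator. **Domain walls.** For $k\in(\mathbb Z/p)^\times$ let $X_k$ be the $\mathrm{Vec}(\mathbb Z/p)$-bimodule category with simple objects $a\in\mathbb Z/p$, action $g\triangleright a\triangleleft h=a+g+kh$ and trivial associators. For $q\in(\mathbb Z/p)^\times$ let $F_q$ be the bimodule category with one simple object $*$, trivial left and right associators and middle associator $(g\triangleright *)\triangleleft h\to g\triangleright(*\triangleleft h)$ equal to $\omega^{qgh}$. Write $\mathrm{tw}(X_k)=0$, $\mathrm{tw}(F_q)=q$. **Defects.** For walls $M$ (below) and $P$ (above), the annular category algebra $\mathrm{Ann}(M,P)$ has basis the diagrams $[m,n;g,h]$, with $m\in M$, $n\in P$ the wall labels on the inside and $g,h\in\mathbb Z/p$ the left and right strings; the wall labels on the outside are $g\triangleright m\triangleleft h$, $g\triangleright n\triangleleft h$. Gluing $[m',n';g',h']$ to the outside of $[m,n;g,h]$ gives $\omega^{(\mathrm{tw}(M)-\mathrm{tw}(P))\,g'h}[m,n;g+g',h+h']$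 if the wall labels match and $0$ otherwise. Binary interface defects between $M$ and $P$ are the left modules of $\mathrm{Ann}(M,P)$; an idempotent $e$ gives the defect $\mathrm{Ann}(M,P)\,e$, also denoted $e$. Put $\Theta_{x,a}(g)=\omega^{gx+ag^2/2}$ if $p$ is odd and $\Theta_{x,a}(g)=(-1)^{gx}i^{ag}$, with $a,g,x$ represented in $\{0,1\}$, if $p=2$. Consider the idempotents $$F_qX_l^{x}=\tfrac1p\sum_g\Theta_{x,-ql}(g)\,[*,0;lg,-g],\qquad X_kX_k^{a,x}=\tfrac1p\sum_g\omega^{gx}\,[0,a;kg,-g],\qquad X_kX_l=[0,0;0,0]\ (k\ne l).$$ The first are the twists. For $p=2$ write $\sigma^x=F_1X_1^{x}$ and $e^xm^a=X_1X_1^{a,x}$. **Fusion.** Let $e$ be a defect between $M$ and $P$, let $f$ be a defect between $N$ and $Q$, and let $R\simeq M\otimes_{\mathrm{Vec}(\mathbb Z/p)}N$ and $S\simeq P\otimes_{\mathrm{Vec}(\mathbb Z/p)}Q$. The (horizontal) fusion $e\otimes f$ is the space of string diagrams on a pair of pants, with $M,P$ on the left leg and $N,Q$ on the right leg, that absorb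 $e$ and $f$ on the legs; it is a representation of $\mathrm{Ann}(R,S)$, which acts by inflating annuli along the two equivalences and gluing them to the waist. The equivalences used are $X_{kl}\simeq X_k\otimes X_l$, $a\mapsto(a,0)$; $F_{ql}\simeq F_q\otimes X_l$, $*\mapsto(*,0)$; and $X_{q^{-1}s}\simeq F_q\otimes F_s$, $a\mapsto$ the image of the idempotent $\frac1p\sum_k\omega^{qak}[k]$ on $(*,*)$, where $[k]$ is the string $k$ between the two walls. **Theorem.** For all units $q,l,s,n,m$ and all elements $x,z,c$ of $\mathbb Z/p$, the following isomorphisms of representations of annular categories hold. 1. (Twist fusion) If $p$ is odd and $q^{-1}s=ln$, then $F_qX_l^{x}\otimes F_sX_n^{z}\cong\bigoplus_{\alpha\in\mathbb Z/p}X_{ln}X_{ln}^{\alpha,\;z+nx-nq\alpha}$. 2. If $q^{-1}s\neq ln$, then $F_qX_l^{x}\otimes F_sX_n^{z}\cong X_{q^{-1}s}X_{ln}$, with multiplicity one. 3. (Twist–anyon fusion) $F_qX_l^{x}\otimes X_mX_m^{c,z}\cong F_{qm}X_{lm}^{\;z+m(x+qlc)}$. 4. If $p=2$, then $\sigma^x\otimes\sigma^z\cong\bigoplus_{j\in\mathbb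 Z/2}e^{j+x+z}m^{j}$. 5. If $p=2$, then $\sigma^x\otimes m^ce^z\cong\sigma^{x+z+c}$. -/

import Mathlib

open scoped DirectSum ComplexConjugate

noncomputable section

/-! ## Domain walls

`Vec(ℤ/p)` is the fusion category of `ℤ/p`-graded complex vector spaces with trivial associator. -/

/-- A skeletal (finite semisimple) bimodule category over `Vec(ℤ/p)`, whose left and right module
associators are trivial and whose middle associator `(g ▹ m) ◃ h ⟶ g ▹ (m ◃ h)` is the bicharacter
`Ω(g,h) = ω ^ (tw * g * h)`, `ω = exp (2πi/p)`.  Here `act g m h` is the simple object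
`g ▹ m ◃ h`. -/
structure Wall (p : ℕ) where
  /-- the simple objects -/
  Obj : Type
  [fin : Fintype Obj]
  [dec : DecidableEq Obj]
  act : ZMod p → Obj → ZMod p → Obj
  act_zero : ∀ m, act 0 m 0 = m
  act_act : ∀ g' g m h h', act g' (act g m h) h' = act (g' + g) m (h + h')
  tw : ZMod p

attribute [instance] Wall.fin Wall.dec

/-- The bimodule `X_k`: simple objects `a ∈ ℤ/p`, `g ▹ a ◃ h = a + g + k h`, no associator. -/
abbrev Wall.X {p : ℕ} [NeZero p] (k : (ZMod p)ˣ) : Wall p where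
  Obj := ZMod p
  act g a h := a + g + k * h
  act_zero _ := by ring
  act_act _ _ _ _ _ := by ring
  tw := 0

/-- The bimodule `F_q`: one simple object `*`, middle associator `ω ^ (q g h)`. -/
abbrev Wall.F {p : ℕ} (q : (ZMod p)ˣ) : Wall p where
  Obj := Unit
  act _ _ _ := ()
  act_zero _ := rfl
  act_act _ _ _ _ _ := rfl
  tw := q

/-! ## Skein spaces -/

/-- The combinatorial data of a surface decorated by domain walls.  A string diagram on the surface
is given, in standard form, by the wall labels `x : Lab` at the inner boundary and the string
labels `s : Str`; the strings change the wall labels to `act s x`.  Gluing the diagram `(act s x, t)`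
to the outside of `(x, s)` and bringing the result into standard form gives
`ω ^ (cross t s)` times the diagram `(x, t + s)`. -/
structure Surface (p : ℕ) where
  Str : Type
  [strGroup : AddCommGroup Str]
  [strFin : Fintype Str]
  [strDec : DecidableEq Str]
  Lab : Type
  [labFin : Fintype Lab]
  [labDec : DecidableEq Lab]
  act : Str → Lab → Lab
  act_zero : ∀ x, act 0 x = x
  act_add : ∀ t s x, act (t + s) x = act t (act s x)
  cross : Str → Str → ZMod p
  cross_add_left : ∀ t t' s, cross (t + t') s = cross t s + cross t' s
  cross_add_right : ∀ t s s', cross t (s + s') = cross t s + cross t s'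

attribute [instance] Surface.strGroup Surface.strFin Surface.strDec Surface.labFin Surface.labDec

/-- The skein space: formal complex combinations of string diagrams, `a x s` being the coefficient
of the diagram `(x, s)`. -/
def Skein {p : ℕ} (S : Surface p) : Type := S.Lab → S.Str → ℂ

namespace Skein

variable {p : ℕ} {S : Surface p}

instance : AddCommGroup (Skein S) := inferInstanceAs (AddCommGroup (S.Lab → S.Str → ℂ))

instance : Module ℂ (Skein S) := inferInstanceAs (Module ℂ (S.Lab → S.Str → ℂ))

/-- A single diagram, with inner labels `x` and strings `s`. -/
def diagram (x : S.Lab) (s : S.Str) : Skein S := fun x' s' => if x' = x ∧ s' = s then 1 else 0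

/-- The sum, over all labels, of the diagrams without strings. -/
instance : One (Skein S) := ⟨fun _ s => if s = 0 then 1 else 0⟩

theorem one_apply (x : S.Lab) (s : S.Str) : (1 : Skein S) x s = if s = 0 then 1 else 0 := rfl

theorem add_apply (b a : Skein S) (x : S.Lab) (s : S.Str) : (b + a) x s = b x s + a x s := rfl

theorem zero_apply (x : S.Lab) (s : S.Str) : (0 : Skein S) x s = 0 := rfl

theorem cross_zero_left (s : S.Str) : S.cross 0 s = 0 := by
  have h := S.cross_add_left 0 0 s
  rw [add_zero] at h
  exact left_eq_add.mp h

theorem cross_zero_right (s : S.Str) : S.cross s 0 = 0 := by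
  have h := S.cross_add_right s 0 0
  rw [add_zero] at h
  exact left_eq_add.mp h

variable [NeZero p]

/-- Gluing of diagrams: `b * a` has `a` on the inside and `b` on the outside, and is zero on
diagrams whose wall labels do not match. -/
instance : Mul (Skein S) :=
  ⟨fun b a x s => ∑ t, ZMod.stdAddChar (S.cross (s - t) t) * b (S.act t x) (s - t) * a x t⟩

theorem mul_apply (b a : Skein S) (x : S.Lab) (s : S.Str) : (b * a) x s =
    ∑ t, ZMod.stdAddChar (S.cross (s - t) t) * b (S.act t x) (s - t) * a x t := rfl

theorem mul_assoc' (c b a : Skein S) : c * b * a = c * (b * a) := by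
  funext x s
  simp only [mul_apply, Finset.mul_sum, Finset.sum_mul]
  rw [Finset.sum_comm (s := Finset.univ) (t := Finset.univ) (f := fun v t =>
    (ZMod.stdAddChar (S.cross (s - v) v) : ℂ) * c (S.act v x) (s - v) *
      (ZMod.stdAddChar (S.cross (v - t) t) * b (S.act t x) (v - t) * a x t))]
  refine Finset.sum_congr rfl fun t _ => ?_
  refine Fintype.sum_equiv (Equiv.addRight t) _ _ fun u => ?_
  have h1 : s - t - u = s - (u + t) := by abel
  have h2 : u + t - t = u := by abel
  have h3 : s - t = (s - (u + t)) + u := by abel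
  simp only [Equiv.coe_addRight]
  rw [h1, h2, S.act_add, h3, S.cross_add_left, S.cross_add_right, AddChar.map_add_eq_mul,
    AddChar.map_add_eq_mul]
  ring

instance : Ring (Skein S) :=
  { (inferInstance : AddCommGroup (Skein S)), (inferInstance : Mul (Skein S)),
    (inferInstance : One (Skein S)) with
    left_distrib := fun c b a => by
      funext x s; simp only [mul_apply, add_apply, mul_add, Finset.sum_add_distrib]
    right_distrib := fun c b a => by
      funext x s; simp only [mul_apply, add_apply, mul_add, add_mul, Finset.sum_add_distrib]
    zero_mul := fun a => by
      funext x s; simp only [mul_apply, zero_apply, mul_zero, zero_mul, Finset.sum_const_zero]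
    mul_zero := fun a => by
      funext x s; simp only [mul_apply, zero_apply, mul_zero, Finset.sum_const_zero]
    mul_assoc := mul_assoc'
    one_mul := fun a => by
      funext x s
      simp only [mul_apply, one_apply, sub_eq_zero]
      rw [Finset.sum_eq_single s]
      · simp [cross_zero_left]
      · intro t _ ht; simp [Ne.symm ht]
      · simp
    mul_one := fun a => by
      funext x s
      simp only [mul_apply, one_apply]
      rw [Finset.sum_eq_single 0]
      · simp [cross_zero_right, S.act_zero]
      · intro t _ ht; simp [ht]
      · simp }

end Skein

/-! ## Annuli and binary interface defects -/

/-- The annulus with lower wall `M` and upper wall `P`.  A diagram has a string `s.1` in the left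
region and a string `s.2` in the right region, both ending on `M` and on `P`.  In standard form the
left string ends on each wall further inside than the right one; gluing moves the left string of the
outer annulus past the right string of the inner one, on the upper wall in the opposite sense. -/
abbrev annulus {p : ℕ} [NeZero p] (M P : Wall p) : Surface p where
  Str := ZMod p × ZMod p
  Lab := M.Obj × P.Obj
  act s x := (M.act s.1 x.1 s.2, P.act s.1 x.2 s.2)
  act_zero x := by simp [M.act_zero, P.act_zero]
  act_add t s x := by
    simp only [M.act_act, P.act_act, Prod.fst_add, Prod.snd_add, add_comm]
  cross t s := M.tw * t.1 * s.2 - P.tw * t.1 * s.2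
  cross_add_left t t' s := by simp only [Prod.fst_add]; ring
  cross_add_right t s s' := by simp only [Prod.snd_add]; ring

/-- The annular category of `M`, `P`, as its category algebra. Binary interface defects between `M`
(below) and `P` (above) are the representations, that is, the left modules, of this algebra. -/
def Ann {p : ℕ} [NeZero p] (M P : Wall p) : Type := Skein (annulus M P)

instance {p : ℕ} [NeZero p] (M P : Wall p) : Ring (Ann M P) :=
  inferInstanceAs (Ring (Skein (annulus M P)))

instance {p : ℕ} [NeZero p] (M P : Wall p) : Module ℂ (Ann M P) :=
  inferInstanceAs (Module ℂ (Skein (annulus M P)))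

theorem Ann.add_apply {p : ℕ} [NeZero p] {M P : Wall p} (b a : Ann M P) (x : M.Obj × P.Obj)
    (s : ZMod p × ZMod p) : (b + a) x s = b x s + a x s := rfl

theorem Ann.mul_apply {p : ℕ} [NeZero p] {M P : Wall p} (b a : Ann M P) (x : M.Obj × P.Obj)
    (s : ZMod p × ZMod p) : (b * a) x s = ∑ t, ZMod.stdAddChar ((annulus M P).cross (s - t) t) *
      b ((annulus M P).act t x) (s - t) * a x t := rfl

/-- A single annular diagram, with wall labels `m`, `n` on the inside, left string `g` and right
string `h`. -/
def annDiagram {p : ℕ} [NeZero p] {M P : Wall p} (m : M.Obj) (n : P.Obj) (g h : ZMod p) : Ann M P :=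
  Skein.diagram (S := annulus M P) (m, n) (g, h)

/-- The defect given by an idempotent `e` of the annular category: the left module `Ann(M,P) · e`
of all annular diagrams that absorb `e` on the inside. -/
abbrev Defect {p : ℕ} [NeZero p] {M P : Wall p} (e : Ann M P) : Type :=
  ↥(Ideal.span ({e} : Set (Ann M P)))

/-- The function `Θ_{x,a}`. -/
def Theta {p : ℕ} [NeZero p] (x a g : ZMod p) : ℂ :=
  if p = 2 then (-1) ^ (g.val * x.val) * Complex.I ^ (a.val * g.val)
  else ZMod.stdAddChar (g * x + a * g ^ 2 * 2⁻¹)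

/-- The idempotent `F_q X_l ^ x` (a generalised twist). -/
def idemFX {p : ℕ} [NeZero p] (q l : (ZMod p)ˣ) (x : ZMod p) : Ann (Wall.F q) (Wall.X l) :=
  (1 / p : ℂ) • ∑ g : ZMod p, Theta x (-(q * l)) g •
    annDiagram (M := Wall.F q) (P := Wall.X l) () (0 : ZMod p) (l * g) (-g)

/-- The idempotent `X_k X_k ^ {a, x}`; for `k = 1` this is the anyon `e ^ x m ^ a`. -/
def idemXXsame {p : ℕ} [NeZero p] (k : (ZMod p)ˣ) (a x : ZMod p) : Ann (Wall.X k) (Wall.X k) :=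
  (1 / p : ℂ) • ∑ g : ZMod p, (ZMod.stdAddChar (g * x) : ℂ) •
    annDiagram (M := Wall.X k) (P := Wall.X k) (0 : ZMod p) a (k * g) (-g)

/-- The idempotent `X_k X_l` (for `k ≠ l`). -/
def idemXX {p : ℕ} [NeZero p] (k l : (ZMod p)ˣ) : Ann (Wall.X k) (Wall.X l) :=
  annDiagram (M := Wall.X k) (P := Wall.X l) (0 : ZMod p) (0 : ZMod p) 0 0

/-- The twist `σ ^ x` of the `ℤ/2` model. -/
abbrev sigmaTwist (x : ZMod 2) : Ann (Wall.F (1 : (ZMod 2)ˣ)) (Wall.X 1) := idemFX 1 1 x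

/-- The anyon `e ^ x m ^ a` of the `ℤ/2` model. -/
abbrev anyonEM (x a : ZMod 2) : Ann (Wall.X (1 : (ZMod 2)ˣ)) (Wall.X 1) := idemXXsame 1 a x

/-! ## Fusion of domain walls -/

/-- An identification `R ≃ M ⊗ N` of the relative tensor product over `Vec(ℤ/p)` with a bimodule
`R`.  `M ⊗ N` is the idempotent completion (with finite sums) of the ladder category: objects are
pairs `(m, n)`, and a rung `k : ℤ/p` is a morphism `(m, n) ⟶ (m ◃ k, (-k) ▹ n)`.  The trivalent
vertex of `R` with label `r`, left string `g` and right string `h` is inflated to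
`∑ₖ coeff r (m, n) g k h [g, k, h]`, where the diagram `[g, k, h]` on the walls labelled `m, n` has
left string `g`, rung `k`, right string `h`. -/
structure Inflation {p : ℕ} [NeZero p] (M N R : Wall p) where
  coeff : R.Obj → M.Obj × N.Obj → ZMod p → ZMod p → ZMod p → ℂ
  /-- compatibility with gluing: inflated vertices compose as those of `R` -/
  comp : ∀ r r' m n g₀ h₀ g₁ h₁ k,
    (∑ k₀, ZMod.stdAddChar (M.tw * g₁ * k₀ + N.tw * (-(k - k₀)) * h₀) *
      coeff r' (M.act g₀ m k₀, N.act (-k₀) n h₀) g₁ (k - k₀) h₁ * coeff r (m, n) g₀ k₀ h₀) =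
    if r' = R.act g₀ r h₀ then
      ZMod.stdAddChar (R.tw * g₁ * h₀) * coeff r (m, n) (g₀ + g₁) k (h₀ + h₁) else 0
  /-- every object is isomorphic to a sum of inflated simple objects -/
  surj : ∀ m n, ∃ k, ∀ k',
    ∑ r, coeff r (M.act 0 m k, N.act (-k) n 0) 0 k' 0 = if k' = 0 then 1 else 0
  /-- inflated simple objects are nonzero -/
  ne_zero : ∀ r, ∃ m n k, coeff r (m, n) 0 k 0 ≠ 0
  /-- inflated simple objects are simple and pairwise non-isomorphic -/
  simple : ∀ r r' y k, ∃ c : ℂ, ∀ m n k',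
    (∑ k₀, if (M.act 0 m k₀, N.act (-k₀) n 0) = y then
      coeff r' (M.act 0 m (k₀ + k), N.act (-(k₀ + k)) n 0) 0 (k' - (k₀ + k)) 0 *
        coeff r (m, n) 0 k₀ 0 else 0) =
    if r' = r then c * coeff r (m, n) 0 k' 0 else 0

namespace Inflation

variable {p : ℕ} [NeZero p]

theorem sum_char (c : ZMod p) : (∑ k : ZMod p, (ZMod.stdAddChar (c * k) : ℂ)) =
    if c = 0 then (p : ℂ) else 0 := by
  have h := AddChar.sum_mulShift (R' := ℂ) c (ZMod.isPrimitive_stdAddChar p)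
  rw [ZMod.card] at h
  have h' : (if c = 0 then (p : ℂ) else 0) = ((if c = 0 then p else 0 : ℕ) : ℂ) := by
    split_ifs <;> simp
  rw [h', ← h]
  exact Finset.sum_congr rfl fun k _ => by rw [mul_comm]

/-- `X_m ≃ X_k ⊗ X_l` for `m = k l`: the object `a` is inflated to `(a, 0)`. -/
def XX (k l m : (ZMod p)ˣ) (hm : m = k * l) : Inflation (Wall.X k) (Wall.X l) (Wall.X m) where
  coeff a y _ r h := if y.1 = a ∧ y.2 = (0 : ZMod p) ∧ r = l * h then 1 else 0
  comp := by
    subst hm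
    intro r r' (m : ZMod p) (n : ZMod p) g₀ h₀ g₁ h₁ j
    simp only [Wall.X]
    rw [Finset.sum_eq_single (l * h₀)]
    · by_cases h1 : m = r ∧ n = 0
      · obtain ⟨rfl, rfl⟩ := h1
        have e1 : m + g₀ + ((k * l : (ZMod p)ˣ) : ZMod p) * h₀ = m + g₀ + (k : ZMod p) * (l * h₀) := by
          rw [Units.val_mul, mul_assoc]
        have e2 : (j - (l : ZMod p) * h₀ = l * h₁) ↔ j = l * (h₀ + h₁) := by
          rw [sub_eq_iff_eq_add, mul_add, add_comm]
        rw [e1]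
        by_cases hr : r' = m + g₀ + (k : ZMod p) * (l * h₀)
        · simp [e2, hr]
        · simp [hr, Ne.symm hr]
      · have h2 : ¬ (m = r ∧ n = 0 ∧ True) := by tauto
        have h3 : ¬ (m = r ∧ n = 0 ∧ j = l * (h₀ + h₁)) := by tauto
        simp only [h2, h3, if_false, mul_zero, ite_self]
    · intro b _ hb
      simp [hb]
    · simp
  surj := by
    intro (m : ZMod p) (n : ZMod p)
    refine ⟨n, fun k' => ?_⟩
    simp only [Wall.X]
    rw [Finset.sum_eq_single (m + 0 + (k : ZMod p) * n)]
    · simp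
    · intro b _ hb
      rw [if_neg]
      exact fun h => hb h.1.symm
    · simp
  ne_zero := fun r => ⟨r, (0 : ZMod p), 0, by simp⟩
  simple := by
    intro (r : ZMod p) (r' : ZMod p) y j
    refine ⟨if y = ((r, 0) : ZMod p × ZMod p) ∧ j = 0 then 1 else 0, ?_⟩
    intro (m : ZMod p) (n : ZMod p) k'
    simp only [Wall.X]
    rw [Finset.sum_eq_single 0]
    · by_cases h1 : m = r ∧ n = 0
      · obtain ⟨rfl, rfl⟩ := h1
        by_cases hy : y = ((m, 0) : ZMod p × ZMod p)
        · subst hy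
          by_cases hj : j = 0
          · subst hj
            by_cases hr : r' = m
            · simp [hr]
            · simp [hr, Ne.symm hr]
          · simp [hj]
        · have : ¬ ((m, 0) : ZMod p × ZMod p) = y := fun h => hy h.symm
          simp [hy, this]
      · have h2 : ∀ c : Prop, ¬ (m = r ∧ n = 0 ∧ c) := fun c => by tauto
        simp only [h2, if_false, mul_zero, ite_self]
    · intro b _ hb
      simp [hb]
    · simp

/-- `F_m ≃ F_q ⊗ X_l` for `m = q l`: the object `*` is inflated to `(*, 0)`. -/
def FX (q l m : (ZMod p)ˣ) (hm : m = q * l) : Inflation (Wall.F q) (Wall.X l) (Wall.F m) where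
  coeff _ y _ r h := if y.2 = (0 : ZMod p) ∧ r = l * h then 1 else 0
  comp := by
    subst hm
    intro r r' m (n : ZMod p) g₀ h₀ g₁ h₁ j
    simp only [Wall.X, Wall.F]
    rw [Finset.sum_eq_single (l * h₀)]
    · by_cases h1 : n = 0
      · subst h1
        have e2 : (j - (l : ZMod p) * h₀ = l * h₁) ↔ j = l * (h₀ + h₁) := by
          rw [sub_eq_iff_eq_add, mul_add, add_comm]
        have e3 : (q : ZMod p) * g₁ * (l * h₀) = q * l * g₁ * h₀ := by ring
        simp [e2, e3]
      · simp [h1]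
    · intro b _ hb
      simp [hb]
    · simp
  surj := by
    intro m (n : ZMod p)
    refine ⟨n, fun k' => ?_⟩
    simp [Wall.X, Wall.F]
  ne_zero := fun _ => ⟨(), (0 : ZMod p), 0, by simp⟩
  simple := by
    intro r r' y j
    refine ⟨if y = (((), 0) : Unit × ZMod p) ∧ j = 0 then 1 else 0, ?_⟩
    intro m (n : ZMod p) k'
    simp only [Wall.X, Wall.F]
    rw [Finset.sum_eq_single 0]
    · by_cases h1 : n = 0
      · subst h1
        by_cases hy : y = (((), 0) : Unit × ZMod p)
        · subst hy
          by_cases hj : j = 0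
          · simp [hj]
          · simp [hj]
        · have : ¬ (((), 0) : Unit × ZMod p) = y := fun h => hy h.symm
          simp [hy, this]
      · simp [h1]
    · intro b _ hb
      simp [hb]
    · simp

/-- `X_m ≃ F_q ⊗ F_r` for `m = q⁻¹ r`: the object `a` is inflated to the idempotent
`(1/p) ∑ₖ ω ^ (q a k) [k]` of `(*, *)`. -/
def FF (q r m : (ZMod p)ˣ) (hm : m = q⁻¹ * r) : Inflation (Wall.F q) (Wall.F r) (Wall.X m) where
  coeff a _ g k _ := (1 / p : ℂ) * ZMod.stdAddChar (q * (a + g) * k : ZMod p)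
  comp := by
    subst hm
    intro (a : ZMod p) (b : ZMod p) _ _ g₀ h₀ g₁ h₁ k
    have hp : (p : ℂ) ≠ 0 := Nat.cast_ne_zero.mpr (NeZero.ne p)
    simp only [Wall.X, Wall.F]
    have hqr : (q : ZMod p) * ((q⁻¹ * r : (ZMod p)ˣ) : ZMod p) = r := by
      rw [← Units.val_mul, mul_inv_cancel_left]
    have key : ∀ k₀ : ZMod p,
        ZMod.stdAddChar ((q : ZMod p) * g₁ * k₀ + (r : ZMod p) * (-(k - k₀)) * h₀) *
          ((1 / p : ℂ) * ZMod.stdAddChar ((q : ZMod p) * (b + g₁) * (k - k₀))) *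
          ((1 / p : ℂ) * ZMod.stdAddChar ((q : ZMod p) * (a + g₀) * k₀)) =
        (1 / p : ℂ) * (1 / p : ℂ) *
          ZMod.stdAddChar ((q : ZMod p) * (b + g₁) * k - (r : ZMod p) * k * h₀) *
          ZMod.stdAddChar ((q : ZMod p) * (a + g₀ + ((q⁻¹ * r : (ZMod p)ˣ) : ZMod p) * h₀ - b) * k₀) := by
      intro k₀
      have e : ((q : ZMod p) * g₁ * k₀ + (r : ZMod p) * (-(k - k₀)) * h₀) +
          ((q : ZMod p) * (b + g₁) * (k - k₀)) +
          ((q : ZMod p) * (a + g₀) * k₀) = ((q : ZMod p) * (b + g₁) * k - (r : ZMod p) * k * h₀) +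
          ((q : ZMod p) * (a + g₀ + ((q⁻¹ * r : (ZMod p)ˣ) : ZMod p) * h₀ - b) * k₀) := by
        linear_combination (-h₀ * k₀) * hqr
      have e' := congrArg (fun z => (ZMod.stdAddChar z : ℂ)) e
      simp only [AddChar.map_add_eq_mul] at e'
      rw [AddChar.map_add_eq_mul]
      linear_combination (1 / p : ℂ) * (1 / p : ℂ) * e'
    refine (Finset.sum_congr rfl fun k₀ _ => key k₀).trans ?_
    rw [← Finset.mul_sum, sum_char]
    by_cases hb : b = a + g₀ + ((q⁻¹ * r : (ZMod p)ˣ) : ZMod p) * h₀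
    · rw [if_pos (by rw [hb, sub_self, mul_zero]), if_pos hb, zero_mul, zero_mul,
        AddChar.map_zero_eq_one, one_mul]
      have e : (q : ZMod p) * (b + g₁) * k - (r : ZMod p) * k * h₀ = (q : ZMod p) * (a + (g₀ + g₁)) * k := by
        rw [hb]; linear_combination (k * h₀) * hqr
      rw [e]
      field_simp
    · rw [if_neg hb, if_neg, mul_zero]
      intro h
      have h' := (Units.mul_right_eq_zero q).mp h
      exact hb (sub_eq_zero.mp h').symm
  surj := by
    intro _ _
    refine ⟨0, fun k' => ?_⟩
    have hp : (p : ℂ) ≠ 0 := Nat.cast_ne_zero.mpr (NeZero.ne p)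
    have e : ∀ a : ZMod p, (1 / p : ℂ) * ZMod.stdAddChar ((q : ZMod p) * (a + 0) * k') =
        (1 / p : ℂ) * ZMod.stdAddChar ((q : ZMod p) * k' * a) := fun a => by
      congr 2; ring
    refine (Finset.sum_congr rfl fun a _ => e a).trans ?_
    rw [← Finset.mul_sum, sum_char]
    have : (q : ZMod p) * k' = 0 ↔ k' = 0 := Units.mul_right_eq_zero q
    by_cases hk : k' = 0
    · simp [hk, hp]
    · simp [hk]
  ne_zero := by
    intro _
    have hp : (p : ℂ) ≠ 0 := Nat.cast_ne_zero.mpr (NeZero.ne p)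
    exact ⟨(), (), 0, by simp [hp]⟩
  simple := by
    intro (a : ZMod p) (b : ZMod p) y j
    refine ⟨ZMod.stdAddChar (-((q : ZMod p) * a * j)), ?_⟩
    intro _ _ k'
    have hp : (p : ℂ) ≠ 0 := Nat.cast_ne_zero.mpr (NeZero.ne p)
    have key : ∀ k₀ : ZMod p,
        ((1 / p : ℂ) * ZMod.stdAddChar ((q : ZMod p) * (b + 0) * (k' - (k₀ + j)))) *
          ((1 / p : ℂ) * ZMod.stdAddChar ((q : ZMod p) * (a + 0) * k₀)) =
        (1 / p : ℂ) * (1 / p : ℂ) * ZMod.stdAddChar ((q : ZMod p) * b * (k' - j)) *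
          ZMod.stdAddChar ((q : ZMod p) * (a - b) * k₀) := by
      intro k₀
      have e : ((q : ZMod p) * (b + 0) * (k' - (k₀ + j))) + ((q : ZMod p) * (a + 0) * k₀) =
          ((q : ZMod p) * b * (k' - j)) + ((q : ZMod p) * (a - b) * k₀) := by ring
      have e' := congrArg (fun z => (ZMod.stdAddChar z : ℂ)) e
      simp only [AddChar.map_add_eq_mul] at e'
      linear_combination (1 / p : ℂ) * (1 / p : ℂ) * e'
    have hy : ∀ k₀ : ZMod p, (((Wall.F q).act 0 () k₀, (Wall.F r).act (-k₀) () 0) = y) :=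
      fun _ => rfl
    refine (Finset.sum_congr rfl fun k₀ _ => (if_pos (hy k₀)).trans (key k₀)).trans ?_
    rw [← Finset.mul_sum, sum_char]
    by_cases hb : b = a
    · rw [if_pos (by rw [hb, sub_self, mul_zero]), if_pos hb, hb, add_zero]
      have e : (q : ZMod p) * a * (k' - j) = -((q : ZMod p) * a * j) + (q : ZMod p) * a * k' := by ring
      rw [e, AddChar.map_add_eq_mul]
      field_simp
    · rw [if_neg hb, if_neg, mul_zero]
      intro h
      have h' := (Units.mul_right_eq_zero q).mp h
      exact hb (sub_eq_zero.mp h').symm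

end Inflation

/-! ## Horizontal fusion of defects -/

/-- The pair of pants with walls `M` (below) and `P` (above) meeting the left leg hole, `N` (below)
and `Q` (above) meeting the right one.  In standard form a diagram has a string `k 0` from `M` to `P`
in the left region, a string `k 1` from `M` to `P` on the right of the left leg, a string `k 3` from
`N` to `Q` on the left of the right leg, a string `k 4` from `N` to `Q` in the right region, and a
string `k 2` from `P` to `Q` above both legs.  On every wall the left endpoints are moved further
inside than the right ones. -/
abbrev pants {p : ℕ} [NeZero p] (M N P Q : Wall p) : Surface p where
  Str := Fin 5 → ZMod p
  Lab := M.Obj × N.Obj × P.Obj × Q.Obj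
  act k x := (M.act (k 0) x.1 (k 1), N.act (k 3) x.2.1 (k 4),
    P.act (k 0) x.2.2.1 (k 1 - k 2), Q.act (k 3 + k 2) x.2.2.2 (k 4))
  act_zero x := by simp [M.act_zero, N.act_zero, P.act_zero, Q.act_zero]
  act_add t s x := by
    simp only [M.act_act, N.act_act, P.act_act, Q.act_act, Pi.add_apply]
    have h1 : t 1 + s 1 - (t 2 + s 2) = s 1 - s 2 + (t 1 - t 2) := by ring
    have h2 : t 3 + s 3 + (t 2 + s 2) = t 3 + t 2 + (s 3 + s 2) := by ring
    rw [h1, h2, add_comm (t 1), add_comm (t 4)]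
  cross t k := M.tw * t 0 * k 1 + N.tw * t 3 * k 4 - P.tw * t 0 * (k 1 - k 2)
    - Q.tw * (t 3 + t 2) * k 4
  cross_add_left t t' s := by simp only [Pi.add_apply]; ring
  cross_add_right t s s' := by simp only [Pi.add_apply]; ring

/-- Annular diagrams `e`, `f` drawn around the left and the right leg of the pair of pants. -/
def legs {p : ℕ} [NeZero p] {M N P Q : Wall p} (e : Ann M P) (f : Ann N Q) : Skein (pants M N P Q) :=
  fun x k => if k 2 = 0 then
    e (x.1, x.2.2.1) (k 0, k 1) * f (x.2.1, x.2.2.2) (k 3, k 4) else 0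

/-- An annular diagram of `R`, `S` inflated, along `R ≃ M ⊗ N` and `S ≃ P ⊗ Q`, to a 4-string
annulus around the waist of the pair of pants.  The diagrams on the 4-string annulus are those with
`k 1 + k 3 = 0`: the left string is `k 0`, the right one `k 4`, the rung between `M` and `N` is
`k 1`, and the rung between `P` and `Q` is `k 1 - k 2`.  On the upper walls the diagram is mirrored,
so the coefficients are conjugated. -/
def inflate {p : ℕ} [NeZero p] {M N P Q R S : Wall p} (I : Inflation M N R) (J : Inflation P Q S)
    (y : Ann R S) : Skein (pants M N P Q) :=
  fun x k => if k 1 + k 3 = 0 then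
    ∑ r : R.Obj, ∑ s : S.Obj, y (r, s) (k 0, k 4) * I.coeff r (x.1, x.2.1) (k 0) (k 1) (k 4) *
      conj (J.coeff s (x.2.2.1, x.2.2.2) (k 0) (k 1 - k 2) (k 4)) else 0

theorem sum_waist {p : ℕ} [NeZero p] (f : (Fin 5 → ZMod p) → ℂ)
    (hf : ∀ t, t 1 + t 3 ≠ 0 → f t = 0) :
    ∑ t, f t = ∑ gh : ZMod p × ZMod p, ∑ κ, ∑ κ', f ![gh.1, κ, κ - κ', -κ, gh.2] := by
  rw [← Finset.sum_filter_of_ne (p := fun t => t 1 + t 3 = 0)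
    (fun t _ h => by by_contra h'; exact h (hf t h'))]
  simp only [← Fintype.sum_prod_type']
  refine Finset.sum_bij' (fun t _ => ((t 0, t 4), (t 1, t 1 - t 2)))
    (fun u _ => ![u.1.1, u.2.1, u.2.1 - u.2.2, -u.2.1, u.1.2]) ?_ ?_ ?_ ?_ ?_
  · intros; simp
  · intros; simp
  · intro t ht
    have ht' : t 1 + t 3 = 0 := (Finset.mem_filter.mp ht).2
    have h3 : t 3 = -t 1 := by linear_combination ht'
    funext i
    fin_cases i <;> simp [h3]
  · intros; simp
  · intro t ht
    have ht' : t 1 + t 3 = 0 := (Finset.mem_filter.mp ht).2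
    have h3 : t 3 = -t 1 := by linear_combination ht'
    congr 1
    funext i
    fin_cases i <;> simp [h3]

theorem inflate_add {p : ℕ} [NeZero p] {M N P Q R S : Wall p} (I : Inflation M N R)
    (J : Inflation P Q S) (y x : Ann R S) :
    inflate I J (y + x) = inflate I J y + inflate I J x := by
  funext lab k
  rw [Skein.add_apply]
  simp only [inflate]
  split_ifs
  · simp only [Ann.add_apply, add_mul, Finset.sum_add_distrib]
  · simp

theorem sum_rearrange {K R S : Type} [Fintype K] [Fintype R] [Fintype S] (c : R → S → R → S → ℂ)
    (A : R → R → K → ℂ) (B : S → S → K → ℂ) :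
    ∑ κ, ∑ κ', ∑ r, ∑ s, ∑ r', ∑ s', c r s r' s' * (A r r' κ * B s s' κ') =
      ∑ r, ∑ s, ∑ r', ∑ s', c r s r' s' * ((∑ κ, A r r' κ) * ∑ κ', B s s' κ') := by
  have h : ∑ κ, ∑ κ', ∑ r, ∑ s, ∑ r', ∑ s', c r s r' s' * (A r r' κ * B s s' κ') =
      ∑ u : K × K, ∑ v : R × S × R × S,
        c v.1 v.2.1 v.2.2.1 v.2.2.2 * (A v.1 v.2.2.1 u.1 * B v.2.1 v.2.2.2 u.2) := by
    simp only [Fintype.sum_prod_type]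
  rw [h, Finset.sum_comm]
  simp only [Fintype.sum_prod_type, Finset.sum_mul, Finset.mul_sum]
  refine Finset.sum_congr rfl fun r _ => Finset.sum_congr rfl fun s _ =>
    Finset.sum_congr rfl fun r' _ => Finset.sum_congr rfl fun s' _ => Finset.sum_comm

theorem inflate_mul {p : ℕ} [NeZero p] {M N P Q R S : Wall p} (I : Inflation M N R)
    (J : Inflation P Q S) (y x : Ann R S) :
    inflate I J (y * x) = inflate I J y * inflate I J x := by
  funext lab k
  obtain ⟨m, n, a, b⟩ := lab
  rw [Skein.mul_apply]
  by_cases hk : k 1 + k 3 = 0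
  swap
  · rw [Finset.sum_eq_zero]
    · simp [inflate, hk]
    · intro t _
      by_cases ht : t 1 + t 3 = 0
      · have : (k - t) 1 + (k - t) 3 ≠ 0 := by
          intro h
          apply hk
          simp only [Pi.sub_apply] at h
          linear_combination h + ht
        simp only [inflate, if_neg this, mul_zero, zero_mul]
      · simp only [inflate, if_neg ht, mul_zero]
  have h3 : k 3 = -k 1 := by linear_combination hk
  rw [sum_waist]
  swap
  · intro t ht
    simp only [inflate, if_neg ht, mul_zero]
  simp only [inflate, if_pos hk, Ann.mul_apply, Finset.sum_mul]
  have swap : ∀ F : R.Obj → S.Obj → ZMod p × ZMod p → ℂ,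
      ∑ r, ∑ s, ∑ gh, F r s gh = ∑ gh, ∑ r, ∑ s, F r s gh := by
    intro F
    rw [Finset.sum_comm]
    simp_rw [Finset.sum_comm (s := (Finset.univ : Finset R.Obj))]
    rw [Finset.sum_comm]
  rw [swap]
  refine Finset.sum_congr rfl fun gh _ => ?_
  obtain ⟨g₀, h₀⟩ := gh
  have hI := fun r r' => I.comp r r' m n g₀ h₀ (k 0 - g₀) (k 4 - h₀) (k 1)
  have hJ := fun s s' => J.comp s s' a b g₀ h₀ (k 0 - g₀) (k 4 - h₀) (k 1 - k 2)
  have hterm : ∀ κ κ' : ZMod p,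
      (ZMod.stdAddChar ((pants M N P Q).cross (k - ![g₀, κ, κ - κ', -κ, h₀])
          ![g₀, κ, κ - κ', -κ, h₀]) : ℂ) *
        inflate I J y ((pants M N P Q).act ![g₀, κ, κ - κ', -κ, h₀] (m, n, a, b))
          (k - ![g₀, κ, κ - κ', -κ, h₀]) *
        inflate I J x (m, n, a, b) ![g₀, κ, κ - κ', -κ, h₀] =
      ∑ r, ∑ s, ∑ r', ∑ s', (y (r', s') (k 0 - g₀, k 4 - h₀) * x (r, s) (g₀, h₀)) *
        ((ZMod.stdAddChar (M.tw * (k 0 - g₀) * κ + N.tw * (-(k 1 - κ)) * h₀) *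
          I.coeff r' (M.act g₀ m κ, N.act (-κ) n h₀) (k 0 - g₀) (k 1 - κ) (k 4 - h₀) *
          I.coeff r (m, n) g₀ κ h₀) *
        conj (ZMod.stdAddChar (P.tw * (k 0 - g₀) * κ' + Q.tw * (-(k 1 - k 2 - κ')) * h₀) *
          J.coeff s' (P.act g₀ a κ', Q.act (-κ') b h₀) (k 0 - g₀) (k 1 - k 2 - κ') (k 4 - h₀) *
          J.coeff s (a, b) g₀ κ' h₀)) := by
    intro κ κ'
    have hph : (pants M N P Q).cross (k - ![g₀, κ, κ - κ', -κ, h₀]) ![g₀, κ, κ - κ', -κ, h₀] =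
        (M.tw * (k 0 - g₀) * κ + N.tw * (-(k 1 - κ)) * h₀) +
          -(P.tw * (k 0 - g₀) * κ' + Q.tw * (-(k 1 - k 2 - κ')) * h₀) := by
      simp [h3]
      ring
    have hy : inflate I J y ((pants M N P Q).act ![g₀, κ, κ - κ', -κ, h₀] (m, n, a, b))
          (k - ![g₀, κ, κ - κ', -κ, h₀]) =
        ∑ r', ∑ s', y (r', s') (k 0 - g₀, k 4 - h₀) *
          I.coeff r' (M.act g₀ m κ, N.act (-κ) n h₀) (k 0 - g₀) (k 1 - κ) (k 4 - h₀) *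
          conj (J.coeff s' (P.act g₀ a κ', Q.act (-κ') b h₀) (k 0 - g₀) (k 1 - k 2 - κ')
            (k 4 - h₀)) := by
      have e1 : k 1 - κ - (k 2 - (κ - κ')) = k 1 - k 2 - κ' := by ring
      have e2 : κ - (κ - κ') = κ' := by ring
      have e3 : -κ + (κ - κ') = -κ' := by ring
      have e4 : k 1 - κ + (k 3 - -κ) = 0 := by rw [h3]; ring
      simp only [inflate]
      rw [if_pos (by simpa using e4)]
      simp only [Pi.sub_apply, Matrix.cons_val, e1, e2, e3]
    have hx : inflate I J x (m, n, a, b) ![g₀, κ, κ - κ', -κ, h₀] =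
        ∑ r, ∑ s, x (r, s) (g₀, h₀) * I.coeff r (m, n) g₀ κ h₀ *
          conj (J.coeff s (a, b) g₀ κ' h₀) := by
      have e2 : κ - (κ - κ') = κ' := by ring
      simp only [inflate]
      rw [if_pos (by simp)]
      simp only [Matrix.cons_val, e2]
    rw [hph, hy, hx, AddChar.map_add_eq_mul, AddChar.map_neg_eq_conj, Finset.mul_sum]
    refine Finset.sum_congr rfl fun r _ => ?_
    rw [Finset.mul_sum]
    refine Finset.sum_congr rfl fun s _ => ?_
    rw [Finset.mul_sum, Finset.sum_mul]
    refine Finset.sum_congr rfl fun r' _ => ?_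
    rw [Finset.mul_sum, Finset.sum_mul]
    refine Finset.sum_congr rfl fun s' _ => ?_
    simp only [map_mul]
    ring
  refine Eq.trans ?_ (Finset.sum_congr rfl fun κ _ => Finset.sum_congr rfl fun κ' _ =>
    (hterm κ κ').symm)
  rw [sum_rearrange]
  refine Finset.sum_congr rfl fun r _ => Finset.sum_congr rfl fun s _ => ?_
  simp only [← map_sum, hI, hJ]
  rw [Finset.sum_eq_single (R.act g₀ r h₀) ?_ (by simp)]
  swap
  · intro r' _ hr
    simp [hr]
  rw [Finset.sum_eq_single (S.act g₀ s h₀) ?_ (by simp)]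
  swap
  · intro s' _ hs
    simp [hs]
  simp only [Prod.mk_sub_mk, sub_eq_add_neg (R.tw * _ * _), AddChar.map_add_eq_mul,
    AddChar.map_neg_eq_conj, if_true, map_mul, add_sub_cancel]
  ring

/-- All combinations of pants diagrams that absorb `e` and `f` on the legs and the inflated
identity of `Ann(R,S)` on the waist. -/
def pantsSubgroup {p : ℕ} [NeZero p] {M N P Q R S : Wall p} (I : Inflation M N R)
    (J : Inflation P Q S) (e : Ann M P) (f : Ann N Q) : AddSubgroup (Skein (pants M N P Q)) where
  carrier := {v | v * legs e f = v ∧ inflate I J 1 * v = v}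
  zero_mem' := ⟨zero_mul _, mul_zero _⟩
  add_mem' := fun ha hb => ⟨by rw [add_mul, ha.1, hb.1], by rw [mul_add, ha.2, hb.2]⟩
  neg_mem' := fun ha => ⟨by rw [neg_mul, ha.1], by rw [mul_neg, ha.2]⟩

/-- The (horizontal) fusion `e ⊗ f` of the defects `e`, `f`, restricted along `R ≃ M ⊗ N` and
`S ≃ P ⊗ Q`. -/
def Fusion {p : ℕ} [NeZero p] {M N P Q R S : Wall p} (I : Inflation M N R) (J : Inflation P Q S)
    (e : Ann M P) (f : Ann N Q) : Type := ↥(pantsSubgroup I J e f)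

instance {p : ℕ} [NeZero p] {M N P Q R S : Wall p} (I : Inflation M N R) (J : Inflation P Q S)
    (e : Ann M P) (f : Ann N Q) : AddCommGroup (Fusion I J e f) :=
  inferInstanceAs (AddCommGroup ↥(pantsSubgroup I J e f))

/-- The fusion is a representation of the annular category of `R`, `S`, which acts by gluing
inflated annuli to the waist. -/
instance {p : ℕ} [NeZero p] {M N P Q R S : Wall p} (I : Inflation M N R) (J : Inflation P Q S)
    (e : Ann M P) (f : Ann N Q) : Module (Ann R S) (Fusion I J e f) where
  smul y v := ⟨inflate I J y * v.1, by rw [mul_assoc, v.2.1],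
    by rw [← mul_assoc, ← inflate_mul, one_mul]⟩
  one_smul v := Subtype.ext v.2.2
  mul_smul y x v := Subtype.ext <| by
    change inflate I J (y * x) * v.1 = inflate I J y * (inflate I J x * v.1)
    rw [inflate_mul, mul_assoc]
  smul_zero y := Subtype.ext (mul_zero _)
  smul_add y v w := Subtype.ext (mul_add _ _ _)
  add_smul y x v := Subtype.ext <| by
    change inflate I J (y + x) * v.1 = inflate I J y * v.1 + inflate I J x * v.1
    rw [inflate_add, add_mul]
  zero_smul v := Subtype.ext <| by
    change inflate I J 0 * v.1 = 0
    have h := inflate_add I J 0 0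
    rw [add_zero] at h
    rw [left_eq_add.mp h, zero_mul]

end

/-! Every idempotent in question is the average of the diagrams over a finite group `H` of strings
fixing a base label, weighted by a function `H → ℂ` that is multiplicative up to the crossing phase
(`TwistedCharacter`). Absorbing such an idempotent means being supported on the base label and
transforming by the twisted character under translation by `H` (`apply_add_hom`,
`mul_idem_eq_self`). The defect is therefore the space of arbitrary functions on a transversal of
`H` in the strings. Two twisted characters on the legs combine to one for `H × H'` on the pair of
pants (`legs_annIdem`), so fusions have coordinates of the same kind; absorbing the inflated
identity at the waist only restricts which outer labels, hence which strings, may carry a nonzero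
coefficient.

For each summand fix a pants diagram whose outer labels are the inflation of the base label of that
summand. Gluing inflated annuli to it gives a linear map over the annular category from the sum of
defects to the fusion, and `nonempty_fusion_equiv` reduces its bijectivity to that of its matrix `T`
in these coordinates.

For two twists, `twist_fusion_apply` computes `T` as a sum over a right string `h`. If `q⁻¹ s = l
n`, the quadratic phases in `h` cancel, and the linear ones cancel exactly for the anyon label `z +
n x - n q α`; the sum over `h` is constant and `T` is a Fourier transform in `α`. Otherwise the
phase pairs `h` with a pants coordinate at frequency `q l n - s ≠ 0`, and `T` is a Fourier transform
in `h`. Both are inverted by `bijective_shearedFourier`. For a twist and an anyon all phases cancel,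
and `T` is a translation up to a scalar. The function `Theta` obeys the same identities for `p = 2`
as for odd `p`, so the `ℤ/2` rules are instances of the general ones. -/

noncomputable section

/-! ### Idempotents from twisted characters of string groups -/

namespace Skein

variable {p : ℕ} {S : Surface p}

theorem sum_apply {ι : Type*} (t : Finset ι) (f : ι → Skein S) (x : S.Lab) (s : S.Str) :
    (∑ i ∈ t, f i) x s = ∑ i ∈ t, f i x s := by
  have h := map_sum (AddMonoidHom.mk' (fun a : Skein S => a x s) fun a b => add_apply a b x s) f t
  exact h

theorem smul_apply (c : ℂ) (a : Skein S) (x : S.Lab) (s : S.Str) : (c • a) x s = c * a x s := rfl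

theorem diagram_apply (x x' : S.Lab) (s s' : S.Str) :
    (diagram x s : Skein S) x' s' = if x' = x ∧ s' = s then 1 else 0 := rfl

variable [NeZero p]

theorem mul_diagram_apply (b : Skein S) (x : S.Lab) (t s : S.Str) :
    (b * diagram x t) x s = ZMod.stdAddChar (S.cross (s - t) t) * b (S.act t x) (s - t) := by
  rw [mul_apply, Finset.sum_eq_single t]
  · simp [diagram_apply]
  · intro u _ hu
    simp [diagram_apply, hu]
  · simp

/-- A subgroup of strings fixing a label, with a function that is multiplicative up to the
crossing cocycle. -/
structure TwistedCharacter (S : Surface p) (H : Type) [AddCommGroup H] where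
  base : S.Lab
  hom : H →+ S.Str
  act_hom : ∀ h, S.act (hom h) base = base
  char : H → ℂ
  char_zero : char 0 = 1
  char_add : ∀ h h', char (h + h') =
    char h * char h' * ZMod.stdAddChar (S.cross (hom h) (hom h'))

namespace TwistedCharacter

variable {H : Type} [AddCommGroup H] [Fintype H]

/-- The idempotent of a twisted character: the weighted average of its diagrams. -/
def idem (E : TwistedCharacter S H) : Skein S :=
  (1 / Fintype.card H : ℂ) • ∑ h, E.char h • diagram E.base (E.hom h)

variable (E : TwistedCharacter S H)

theorem idem_apply (x : S.Lab) (s : S.Str) : E.idem x s =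
    if x = E.base then (1 / Fintype.card H : ℂ) * ∑ h, if s = E.hom h then E.char h else 0
    else 0 := by
  rw [idem, smul_apply, sum_apply]
  simp only [smul_apply, diagram_apply]
  by_cases hx : x = E.base <;> simp [hx]

theorem mul_idem_apply (y : Skein S) (x : S.Lab) (s : S.Str) : (y * E.idem) x s =
    if x = E.base then (1 / Fintype.card H : ℂ) * ∑ h, E.char h *
      ZMod.stdAddChar (S.cross (s - E.hom h) (E.hom h)) * y E.base (s - E.hom h)
    else 0 := by
  rw [mul_apply]
  simp only [idem_apply]
  by_cases hx : x = E.base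
  · subst hx
    simp only [if_true, Finset.mul_sum]
    rw [Finset.sum_comm]
    refine Finset.sum_congr rfl fun h _ => ?_
    rw [Finset.sum_eq_single (E.hom h)]
    · rw [E.act_hom, if_pos rfl]
      ring
    · intro t _ ht
      simp [ht]
    · simp
  · simp [hx]

theorem apply_eq_zero {y : Skein S} (hy : y * E.idem = y) {x : S.Lab} (hx : x ≠ E.base)
    (s : S.Str) : y x s = 0 := by
  rw [← hy, mul_idem_apply, if_neg hx]

/-- Shift the averaging variable by `h`: the cocycle in `char_add` matches the change of crossing
phase because `cross` is biadditive. -/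
theorem apply_add_hom {y : Skein S} (hy : y * E.idem = y) (s : S.Str) (h : H) :
    y E.base (s + E.hom h) =
      E.char h * ZMod.stdAddChar (S.cross s (E.hom h)) * y E.base s := by
  rw [← hy, mul_idem_apply, mul_idem_apply, if_pos rfl, if_pos rfl, mul_left_comm]
  congr 1
  rw [Finset.mul_sum]
  refine (Fintype.sum_equiv (Equiv.addRight h) _ _ fun u => ?_).symm
  have h1 : s + E.hom h - E.hom (u + h) = s - E.hom u := by rw [map_add]; abel
  have h2 : S.cross s (E.hom h) = S.cross (s - E.hom u) (E.hom h) +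
      S.cross (E.hom u) (E.hom h) := by
    rw [← S.cross_add_left, sub_add_cancel]
  rw [Equiv.coe_addRight, h1, E.char_add, map_add, S.cross_add_right, h2,
    AddChar.map_add_eq_mul, AddChar.map_add_eq_mul]
  ring

/-- Equivariance makes all `Fintype.card H` terms of the average equal. -/
theorem mul_idem_eq_self {y : Skein S} (h0 : ∀ x s, x ≠ E.base → y x s = 0)
    (hadd : ∀ s h, y E.base (s + E.hom h) =
      E.char h * ZMod.stdAddChar (S.cross s (E.hom h)) * y E.base s) : y * E.idem = y := by
  funext x s
  rw [mul_idem_apply]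
  split_ifs with hx
  · subst hx
    have hc : (Fintype.card H : ℂ) ≠ 0 := Nat.cast_ne_zero.mpr Fintype.card_ne_zero
    simp only [← hadd, sub_add_cancel, Finset.sum_const, Finset.card_univ, nsmul_eq_mul]
    field_simp
  · exact (h0 x s hx).symm

theorem idem_mul_idem : E.idem * E.idem = E.idem := by
  refine E.mul_idem_eq_self (fun x s hx => by rw [idem_apply, if_neg hx]) fun s h => ?_
  rw [idem_apply, idem_apply, if_pos rfl, if_pos rfl, mul_left_comm]
  congr 1
  rw [Finset.mul_sum]
  refine (Fintype.sum_equiv (Equiv.addRight h) _ _ fun u => ?_).symm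
  simp only [Equiv.coe_addRight, map_add, add_left_inj]
  split_ifs with hs
  · rw [E.char_add, hs]
    ring
  · rw [mul_zero]

/-- The vanishing alternative in `hσ` is for the pair of pants, where the waist condition kills the
strings outside the normal forms. -/
theorem ext_of_transversal {K : Type*} (σ : K → S.Str) {v w : Skein S} (hv : v * E.idem = v)
    (hw : w * E.idem = w)
    (hσ : ∀ s, (v E.base s = 0 ∧ w E.base s = 0) ∨ ∃ k h, s = σ k + E.hom h)
    (h : ∀ k, v E.base (σ k) = w E.base (σ k)) : v = w := by
  funext x s
  by_cases hx : x = E.base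
  · subst hx
    rcases hσ s with h0 | ⟨k, u, rfl⟩
    · rw [h0.1, h0.2]
    · rw [E.apply_add_hom hv, E.apply_add_hom hw, h]
  · rw [E.apply_eq_zero hv hx, E.apply_eq_zero hw hx]

/-- Values on a transversal extend by the transformation law; the extension is consistent because
`char` satisfies the cocycle identity. -/
theorem exists_of_transversal {K : Type*} (σ : K → S.Str) (π : S.Str → K) (ρ : S.Str → H)
    (hπ : ∀ s, σ (π s) + E.hom (ρ s) = s) (hπ' : ∀ s h, π (s + E.hom h) = π s)
    (hρ : ∀ s h, ρ (s + E.hom h) = ρ s + h) (hσ : ∀ k, π (σ k) = k) (hσ' : ∀ k, ρ (σ k) = 0)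
    (Y : K → ℂ) : ∃ y : Skein S, y * E.idem = y ∧ ∀ k, y E.base (σ k) = Y k := by
  refine ⟨fun x s => if x = E.base then E.char (ρ s) *
    ZMod.stdAddChar (S.cross (σ (π s)) (E.hom (ρ s))) * Y (π s) else 0,
    E.mul_idem_eq_self (fun x s hx => if_neg hx) fun s h => ?_, fun k => ?_⟩
  · simp only [if_true]
    have hc : S.cross s (E.hom h) = S.cross (σ (π s)) (E.hom h) +
        S.cross (E.hom (ρ s)) (E.hom h) := by
      rw [← S.cross_add_left, hπ]
    rw [hπ', hρ, map_add, E.char_add, S.cross_add_right, hc, AddChar.map_add_eq_mul,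
      AddChar.map_add_eq_mul]
    ring
  · simp only [if_true, hσ, hσ', map_zero, cross_zero_right, E.char_zero,
      AddChar.map_zero_eq_one, one_mul]

end TwistedCharacter

end Skein

open Skein

/-! ### Twisted characters on the legs of the pair of pants -/

section legs

variable {p : ℕ} [NeZero p] {M N P Q : Wall p} {H H' : Type} [AddCommGroup H] [AddCommGroup H']

/-- Twisted characters on both legs give one on the pair of pants. -/
def Skein.TwistedCharacter.legs (E : TwistedCharacter (annulus M P) H)
    (E' : TwistedCharacter (annulus N Q) H') : TwistedCharacter (pants M N P Q) (H × H') where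
  base := (E.base.1, E'.base.1, E.base.2, E'.base.2)
  hom := AddMonoidHom.mk' (fun h => ![(E.hom h.1).1, (E.hom h.1).2, 0, (E'.hom h.2).1,
    (E'.hom h.2).2]) fun a b => by simp
  act_hom h := by
    have h1 := E.act_hom h.1
    have h2 := E'.act_hom h.2
    simp only [Prod.ext_iff] at h1 h2
    simp [h1.1, h1.2, h2.1, h2.2]
  char h := E.char h.1 * E'.char h.2
  char_zero := by simp [E.char_zero, E'.char_zero]
  -- With no string `k 2` and the same labels on both ends of each leg, the crossing on the pants is
  -- the sum of the crossings on the two annuli.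
  char_add h h' := by
    simp only [Prod.fst_add, Prod.snd_add, E.char_add, E'.char_add]
    rw [mul_mul_mul_comm, ← AddChar.map_add_eq_mul]
    congr 1
    · ring
    · congr 1
      simp
      ring

/-- The idempotent of a twisted character as an element of the annular category. -/
def Skein.TwistedCharacter.annIdem [Fintype H] (E : TwistedCharacter (annulus M P) H) : Ann M P :=
  E.idem

/-- A product of two averages is the average over pairs, and a family of pants strings comes from a
pair exactly when `k 2 = 0` and each leg carries strings of its own group. -/
theorem legs_annIdem [Fintype H] [Fintype H'] (E : TwistedCharacter (annulus M P) H)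
    (E' : TwistedCharacter (annulus N Q) H') :
    legs E.annIdem E'.annIdem = (E.legs E').idem := by
  funext x k
  have hk : ∀ h : H × H', k = (E.legs E').hom h ↔
      k 2 = 0 ∧ (k 0, k 1) = E.hom h.1 ∧ (k 3, k 4) = E'.hom h.2 := by
    intro h
    constructor
    · rintro rfl
      exact ⟨rfl, rfl, rfl⟩
    · rintro ⟨h2, h01, h34⟩
      funext i
      fin_cases i
      · exact congrArg Prod.fst h01
      · exact congrArg Prod.snd h01
      · exact h2
      · exact congrArg Prod.fst h34
      · exact congrArg Prod.snd h34
  have hx : x = (E.legs E').base ↔ (x.1, x.2.2.1) = E.base ∧ (x.2.1, x.2.2.2) = E'.base := by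
    simp only [Skein.TwistedCharacter.legs, Prod.ext_iff]
    tauto
  rw [TwistedCharacter.idem_apply]
  simp only [hk, hx, legs, TwistedCharacter.annIdem]
  rw [TwistedCharacter.idem_apply, TwistedCharacter.idem_apply]
  by_cases h2 : k 2 = 0
  · by_cases ha : (x.1, x.2.2.1) = E.base
    · by_cases hb : (x.2.1, x.2.2.2) = E'.base
      · rw [if_pos h2, if_pos ha, if_pos hb, if_pos ⟨ha, hb⟩, mul_mul_mul_comm, Finset.sum_mul_sum,
          Fintype.sum_prod_type, Fintype.card_prod]
        congr 1
        · push_cast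
          ring
        · refine Finset.sum_congr rfl fun h _ => Finset.sum_congr rfl fun h' _ => ?_
          rw [ite_zero_mul_ite_zero]
          exact if_congr (by simp [h2]) rfl rfl
      · simp [hb]
    · simp [ha]
  · simp [h2]

end legs

/-! ### The quadratic functions Θ, uniformly in the prime -/

section Theta

theorem stdAddChar_two_one : (ZMod.stdAddChar (1 : ZMod 2) : ℂ) = -1 := by
  have h := ZMod.stdAddChar_coe (N := 2) 1
  rw [Int.cast_one] at h
  rw [h, ← Complex.exp_pi_mul_I]
  congr 1
  push_cast
  ring

theorem zmod_two_eq (x : ZMod 2) : x = 0 ∨ x = 1 := by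
  revert x
  decide

theorem one_add_one_zmod_two : (1 + 1 : ZMod 2) = 0 := rfl

variable {p : ℕ} [Fact p.Prime]

theorem two_mul_inv_two (hp : p ≠ 2) : (2 : ZMod p) * 2⁻¹ = 1 := by
  refine mul_inv_cancel₀ fun h => hp ?_
  have h' : ((2 : ℕ) : ZMod p) = 0 := by exact_mod_cast h
  exact ((Nat.prime_dvd_prime_iff_eq Fact.out Nat.prime_two).mp
    ((ZMod.natCast_eq_zero_iff 2 p).mp h'))

theorem Theta_zero (x a : ZMod p) : Theta x a 0 = 1 := by
  simp [Theta]

/-- `Theta` is a quadratic function whose polarisation is the bicharacter `a g h`; this makes it a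
twisted character for the crossing cocycle of a twist. For odd `p` it is `2 * 2⁻¹ = 1`, for `p = 2`
it is `I ^ 2 = -1`. -/
theorem Theta_add (x a g h : ZMod p) :
    Theta x a (g + h) = Theta x a g * Theta x a h * ZMod.stdAddChar (a * g * h) := by
  by_cases hp : p = 2
  · subst hp
    rcases zmod_two_eq x with rfl | rfl <;> rcases zmod_two_eq a with rfl | rfl <;>
      rcases zmod_two_eq g with rfl | rfl <;> rcases zmod_two_eq h with rfl | rfl <;>
      simp [Theta, stdAddChar_two_one, ZMod.val_one, one_add_one_zmod_two]
  · simp only [Theta, if_neg hp, ← AddChar.map_add_eq_mul]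
    congr 1
    linear_combination (a * g * h) * two_mul_inv_two hp

theorem Theta_add_left (x y a g : ZMod p) :
    Theta (x + y) a g = Theta x a g * ZMod.stdAddChar (y * g) := by
  by_cases hp : p = 2
  · subst hp
    rcases zmod_two_eq x with rfl | rfl <;> rcases zmod_two_eq a with rfl | rfl <;>
      rcases zmod_two_eq g with rfl | rfl <;> rcases zmod_two_eq y with rfl | rfl <;>
      simp [Theta, stdAddChar_two_one, ZMod.val_one, one_add_one_zmod_two]
  · simp only [Theta, if_neg hp, ← AddChar.map_add_eq_mul]
    congr 1
    ring

theorem Theta_units_mul (x a g : ZMod p) (n : (ZMod p)ˣ) :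
    Theta x a ((n : ZMod p) * g) = Theta ((n : ZMod p) * x) (a * (n : ZMod p) ^ 2) g := by
  by_cases hp : p = 2
  · subst hp
    have hn : n = 1 := Subsingleton.elim _ _
    simp [hn]
  · simp only [Theta, if_neg hp]
    congr 1
    ring

/-- Two half-quadratic exponents add up to a whole one, so the product is a value of the additive
character even for `p = 2`. -/
theorem Theta_mul_self (x y a g : ZMod p) :
    Theta x a g * Theta y a g = ZMod.stdAddChar ((x + y) * g + a * g ^ 2) := by
  by_cases hp : p = 2
  · subst hp
    rcases zmod_two_eq x with rfl | rfl <;> rcases zmod_two_eq a with rfl | rfl <;>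
      rcases zmod_two_eq g with rfl | rfl <;> rcases zmod_two_eq y with rfl | rfl <;>
      simp [Theta, stdAddChar_two_one, ZMod.val_one, one_add_one_zmod_two]
  · simp only [Theta, if_neg hp, ← AddChar.map_add_eq_mul]
    congr 1
    linear_combination (a * g ^ 2) * two_mul_inv_two hp

/-- This is `Theta_add` at `g + (-g) = 0`; it also shows that `Theta` never vanishes. -/
theorem Theta_mul_neg (x a g : ZMod p) :
    Theta x a g * Theta x a (-g) = ZMod.stdAddChar (a * g ^ 2) := by
  have h := Theta_add x a g (-g)
  rw [add_neg_cancel, Theta_zero] at h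
  calc _ = Theta x a g * Theta x a (-g) * (ZMod.stdAddChar (a * g * -g) *
        ZMod.stdAddChar (a * g ^ 2)) := by
        rw [← AddChar.map_add_eq_mul, show a * g * -g + a * g ^ 2 = 0 by ring,
          AddChar.map_zero_eq_one, mul_one]
    _ = _ := by rw [← mul_assoc, ← h, one_mul]

theorem stdAddChar_ne_zero (a : ZMod p) : (ZMod.stdAddChar a : ℂ) ≠ 0 :=
  (AddChar.val_isUnit _ a).ne_zero

theorem Theta_ne_zero (x a g : ZMod p) : Theta x a g ≠ 0 :=
  left_ne_zero_of_mul (Theta_mul_neg x a g ▸ stdAddChar_ne_zero _)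

end Theta

/-! ### Inverting a sheared Fourier transform -/

/-- A Fourier transform in the first argument, with twists and a shear. -/
theorem bijective_shearedFourier {p : ℕ} [Fact p.Prime] (A B : ZMod p → ℂ) (hA : ∀ k, A k ≠ 0)
    (hB : ∀ i, B i ≠ 0) (c : ZMod p) (hc : c ≠ 0) (l m : ZMod p) :
    Function.Bijective fun (Y : ZMod p → ZMod p → ℂ) (k : ZMod p × ZMod p) =>
      A k.2 * ∑ i, B i * ZMod.stdAddChar (c * i * k.2) * Y i (k.1 + l * k.2 - m * i) := by
  have hp : (p : ℂ) ≠ 0 := Nat.cast_ne_zero.mpr (NeZero.ne p)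
  rw [Function.bijective_iff_has_inverse]
  -- The inverse undoes the factors `A`, `B` and the shear and applies the conjugate transform; both
  -- composites collapse by orthogonality of characters, as `c ≠ 0`.
  refine ⟨fun V i g => ((p : ℂ) * B i)⁻¹ * ∑ k, (A k)⁻¹ * ZMod.stdAddChar (-(c * i * k)) *
    V (g + m * i - l * k, k), fun Y => ?_, fun V => ?_⟩
  · funext i g
    have h1 : ∀ k j, (A k)⁻¹ * (ZMod.stdAddChar (-(c * i * k)) : ℂ) *
        (A k * (B j * ZMod.stdAddChar (c * j * k) * Y j (g + m * i - l * k + l * k - m * j))) =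
        B j * Y j (g + m * i - m * j) * ZMod.stdAddChar (c * (j - i) * k) := by
      intro k j
      rw [show c * (j - i) * k = -(c * i * k) + c * j * k by ring, AddChar.map_add_eq_mul,
        sub_add_cancel]
      have := hA k
      field_simp
    simp only [Finset.mul_sum, h1]
    rw [Finset.sum_comm]
    simp only [← Finset.mul_sum, Inflation.sum_char]
    rw [Finset.sum_eq_single i]
    · have := hB i
      simp
      field_simp
    · intro j _ hj
      rw [if_neg (mul_ne_zero hc (sub_ne_zero.mpr hj)), mul_zero]
    · simp
  · funext k
    obtain ⟨a, b⟩ := k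
    have h1 : ∀ i k, B i * (ZMod.stdAddChar (c * i * b) : ℂ) * (((p : ℂ) * B i)⁻¹ * ((A k)⁻¹ *
        ZMod.stdAddChar (-(c * i * k)) * V (a + l * b - m * i + m * i - l * k, k))) =
        (p : ℂ)⁻¹ * (A k)⁻¹ * V (a + l * b - l * k, k) *
          ZMod.stdAddChar (c * (b - k) * i) := by
      intro i k
      rw [show c * (b - k) * i = c * i * b + -(c * i * k) by ring, AddChar.map_add_eq_mul,
        sub_add_cancel]
      have := hB i
      field_simp
    simp only [Finset.mul_sum, h1]
    rw [Finset.sum_comm]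
    simp only [← Finset.mul_sum, Inflation.sum_char]
    rw [Finset.sum_eq_single b]
    · have := hA b
      simp
      field_simp
    · intro j _ hj
      rw [if_neg (mul_ne_zero hc (sub_ne_zero.mpr hj.symm)), mul_zero]
    · simp

/-! ### The given idempotents as twisted characters -/

section characters

variable {p : ℕ} [Fact p.Prime]

/-- The twisted character of the twist `F_q X_l ^ x`. -/
def charFX (q l : (ZMod p)ˣ) (x : ZMod p) :
    TwistedCharacter (annulus (Wall.F q) (Wall.X l)) (ZMod p) where
  base := ((), (0 : ZMod p))
  hom := AddMonoidHom.mk' (fun g => ((l : ZMod p) * g, -g)) fun a b => by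
    simp [mul_add, add_comm]
  act_hom h := by simp
  char := Theta x (-(q * l))
  char_zero := Theta_zero _ _
  char_add g h := by
    rw [Theta_add]
    congr 2
    simp only [AddMonoidHom.mk'_apply]
    ring

/-- The twisted character of the defect `X_k X_k ^ {a, x}`. -/
def charXXsame (k : (ZMod p)ˣ) (a x : ZMod p) :
    TwistedCharacter (annulus (Wall.X k) (Wall.X k)) (ZMod p) where
  base := ((0 : ZMod p), a)
  hom := AddMonoidHom.mk' (fun g => ((k : ZMod p) * g, -g)) fun a b => by
    simp [mul_add, add_comm]
  act_hom h := by simp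
  char g := ZMod.stdAddChar (g * x)
  char_zero := by simp
  char_add g h := by simp [add_mul, AddChar.map_add_eq_mul]

/-- The trivial twisted character of the defect `X_k X_l`. -/
def charXX (k l : (ZMod p)ˣ) : TwistedCharacter (annulus (Wall.X k) (Wall.X l)) Unit where
  base := ((0 : ZMod p), (0 : ZMod p))
  hom := 0
  act_hom h := by simp
  char _ := 1
  char_zero := rfl
  char_add _ _ := by simp

theorem idemFX_eq (q l : (ZMod p)ˣ) (x : ZMod p) : idemFX q l x = (charFX q l x).annIdem := by
  rw [TwistedCharacter.annIdem, TwistedCharacter.idem, ZMod.card]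
  rfl

theorem idemXXsame_eq (k : (ZMod p)ˣ) (a x : ZMod p) :
    idemXXsame k a x = (charXXsame k a x).annIdem := by
  rw [TwistedCharacter.annIdem, TwistedCharacter.idem, ZMod.card]
  rfl

theorem idemXX_eq (k l : (ZMod p)ˣ) : idemXX k l = (charXX k l).annIdem := by
  rw [TwistedCharacter.annIdem, TwistedCharacter.idem]
  simp [charXX, idemXX, annDiagram]
  rfl

end characters

/-! ### Inflated annuli and the waist condition -/

section inflate

variable {p : ℕ} [NeZero p] {M N P Q R S : Wall p} (I : Inflation M N R) (J : Inflation P Q S)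

theorem inflate_one_apply (x : (pants M N P Q).Lab) (k : Fin 5 → ZMod p) :
    inflate I J 1 x k = if k 0 = 0 ∧ k 4 = 0 ∧ k 1 + k 3 = 0 then
      (∑ r, I.coeff r (x.1, x.2.1) 0 (k 1) 0) *
        conj (∑ s, J.coeff s (x.2.2.1, x.2.2.2) 0 (k 1 - k 2) 0) else 0 := by
  have h1 : ∀ r s, (1 : Ann R S) (r, s) (k 0, k 4) = if k 0 = 0 ∧ k 4 = 0 then 1 else 0 :=
    fun r s => (one_apply (S := annulus R S) (r, s) (k 0, k 4)).trans
      (if_congr Prod.mk_eq_zero rfl rfl)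
  simp only [inflate, h1]
  by_cases h : k 0 = 0 ∧ k 4 = 0
  · rw [map_sum, Finset.sum_mul_sum]
    simp [h]
  · have h' : ¬ (k 0 = 0 ∧ k 4 = 0 ∧ k 1 + k 3 = 0) := by tauto
    simp only [if_neg h, if_neg h', zero_mul, Finset.sum_const_zero, ite_self]

theorem inflate_apply_of_support {y : Ann R S} {b : R.Obj × S.Obj}
    (hy : ∀ x s, x ≠ b → y x s = 0) (x : (pants M N P Q).Lab) (k : Fin 5 → ZMod p) :
    inflate I J y x k = if k 1 + k 3 = 0 then
      y b (k 0, k 4) * I.coeff b.1 (x.1, x.2.1) (k 0) (k 1) (k 4) *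
        conj (J.coeff b.2 (x.2.2.1, x.2.2.2) (k 0) (k 1 - k 2) (k 4)) else 0 := by
  simp only [inflate]
  congr 1
  rw [← Fintype.sum_prod_type' (f := fun r s => y (r, s) (k 0, k 4) *
    I.coeff r (x.1, x.2.1) (k 0) (k 1) (k 4) *
      conj (J.coeff s (x.2.2.1, x.2.2.2) (k 0) (k 1 - k 2) (k 4)))]
  refine Finset.sum_eq_single b (fun c _ hc => ?_) (by simp)
  rw [hy _ _ hc, zero_mul, zero_mul]

/-- The inflated identity carries no strings, so gluing it to the waist acts diagonally and only
tests the outer labels. -/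
theorem of_inflate_one_mul {c : (pants M N P Q).Lab → Prop}
    (hc : ∀ x k, inflate I J 1 x k ≠ 0 → k = 0 ∧ c x) {v : Skein (pants M N P Q)}
    (hv : inflate I J 1 * v = v) {x : (pants M N P Q).Lab} {s : Fin 5 → ZMod p}
    (h : v x s ≠ 0) : c ((pants M N P Q).act s x) := by
  rw [← hv, mul_apply] at h
  obtain ⟨t, _, ht⟩ := Finset.exists_ne_zero_of_sum_ne_zero h
  obtain ⟨h1, h2⟩ := hc _ _ (right_ne_zero_of_mul (left_ne_zero_of_mul ht))
  rwa [sub_eq_zero.mp h1]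

end inflate

/-! ### Comparing defects and fusions in coordinates -/

theorem Ann.mem_span_idem {p : ℕ} [NeZero p] {M P : Wall p} {e : Ann M P} (he : e * e = e)
    (y : Ann M P) : y ∈ Ideal.span ({e} : Set (Ann M P)) ↔ y * e = y := by
  rw [Ideal.mem_span_singleton']
  constructor
  · rintro ⟨a, rfl⟩
    rw [mul_assoc, he]
  · exact fun h => ⟨y, h⟩

section fusion

variable {p : ℕ} [NeZero p] {M N P Q R S : Wall p} (I : Inflation M N R) (J : Inflation P Q S)

/-- Gluing inflated annuli to a fixed pants diagram absorbing `e` and `f`. -/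
def fusionMap (e : Ann M P) (f : Ann N Q) (ε : Ann R S) (u : Skein (pants M N P Q))
    (hu : u * legs e f = u) : Defect ε →ₗ[Ann R S] Fusion I J e f where
  toFun y := ⟨inflate I J y.1 * u, by rw [mul_assoc, hu], by
    rw [← mul_assoc, ← inflate_mul, one_mul]⟩
  map_add' y z := Subtype.ext <| by
    change inflate I J (y.1 + z.1) * u = inflate I J y.1 * u + inflate I J z.1 * u
    rw [inflate_add, add_mul]
  map_smul' a y := Subtype.ext <| by
    change inflate I J (a * y.1) * u = inflate I J a * (inflate I J y.1 * u)
    rw [inflate_mul, mul_assoc]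

variable {ι H H' H'' K K' : Type} [Fintype ι] [DecidableEq ι] [AddCommGroup H] [AddCommGroup H']
  [AddCommGroup H''] [Fintype H] [Fintype H'] [Fintype H'']

theorem inflate_mul_diagram_mul_idem_apply (G : TwistedCharacter (pants M N P Q) H) (y : Ann R S)
    (d s : Fin 5 → ZMod p) :
    (inflate I J y * (diagram G.base d * G.idem)) G.base s =
      (1 / Fintype.card H : ℂ) * ∑ h, G.char h *
        ZMod.stdAddChar ((pants M N P Q).cross (s - G.hom h) (G.hom h)) *
        (ZMod.stdAddChar ((pants M N P Q).cross (s - G.hom h - d) d) *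
          inflate I J y ((pants M N P Q).act d G.base) (s - G.hom h - d)) := by
  rw [← mul_assoc, TwistedCharacter.mul_idem_apply, if_pos rfl]
  simp only [mul_diagram_apply]

/-- Fusion products of defects given by twisted characters, by comparison of coordinates: `σ` and
`τ` are normal forms for the strings of the annulus and of the pair of pants. -/
theorem nonempty_fusion_equiv {e : Ann M P} {f : Ann N Q} {ε : ι → Ann R S}
    {E : TwistedCharacter (annulus M P) H} (he : e = E.annIdem)
    {E' : TwistedCharacter (annulus N Q) H'} (hf : f = E'.annIdem)
    {G : ι → TwistedCharacter (annulus R S) H''} (hε : ∀ i, ε i = (G i).annIdem)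
    (σ : K → ZMod p × ZMod p) (π : ZMod p × ZMod p → K) (ρ : ZMod p × ZMod p → H'')
    (hπ : ∀ i s, σ (π s) + (G i).hom (ρ s) = s) (hπ' : ∀ i s h, π (s + (G i).hom h) = π s)
    (hρ : ∀ i s h, ρ (s + (G i).hom h) = ρ s + h) (hσ : ∀ k, π (σ k) = k)
    (hσ' : ∀ k, ρ (σ k) = 0)
    (c : (pants M N P Q).Lab → Prop) (hc : ∀ x k, inflate I J 1 x k ≠ 0 → k = 0 ∧ c x)
    (τ : K' → Fin 5 → ZMod p) (hτ : ∀ s, c ((pants M N P Q).act s (E.legs E').base) →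
      ∃ k h, s = τ k + (E.legs E').hom h)
    (d : ι → Fin 5 → ZMod p) (T : (ι → K → ℂ) → K' → ℂ) (hT : Function.Bijective T)
    (hdT : ∀ y : ι → Ann R S, (∀ i, y i * (G i).annIdem = y i) → ∀ k,
      ∑ i, (inflate I J (y i) * (diagram (E.legs E').base (d i) * (E.legs E').idem))
        (E.legs E').base (τ k) = T (fun i k => y i (G i).base (σ k)) k) :
    Nonempty (Fusion I J e f ≃ₗ[Ann R S] ⨁ i, Defect (ε i)) := by
  obtain rfl : ε = fun i => (G i).annIdem := funext hε
  subst he hf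
  have hu : ∀ i, diagram (E.legs E').base (d i) * (E.legs E').idem * legs E.annIdem E'.annIdem =
      diagram (E.legs E').base (d i) * (E.legs E').idem := fun i => by
    rw [legs_annIdem, mul_assoc, TwistedCharacter.idem_mul_idem]
  let F := fun i => fusionMap I J E.annIdem E'.annIdem (G i).annIdem _ (hu i)
  let Φ := LinearMap.lsum (Ann R S) (fun i => Defect (G i).annIdem) ℕ F
  have hmem : ∀ i (y : Ann R S), y ∈ Ideal.span ({(G i).annIdem} : Set (Ann R S)) ↔
      y * (G i).annIdem = y := fun i => Ann.mem_span_idem (G i).idem_mul_idem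
  -- `C` and `V` are the coordinates on the source and the target of `Φ`. Only injectivity is needed
  -- of `V`.
  let C : (∀ i, Defect (G i).annIdem) → ι → K → ℂ :=
    fun y i k => (y i).1 (G i).base (σ k)
  let V : Fusion I J E.annIdem E'.annIdem → K' → ℂ :=
    fun v k => v.1 (E.legs E').base (τ k)
  have hC : Function.Bijective C := by
    constructor
    · intro y z h
      funext i
      refine Subtype.ext ((G i).ext_of_transversal σ ((hmem i _).mp (y i).2)
        ((hmem i _).mp (z i).2) (fun s => Or.inr ⟨π s, ρ s, (hπ i s).symm⟩) fun k => ?_)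
      exact congrFun (congrFun h i) k
    · intro Y
      choose y hy hy' using fun i =>
        (G i).exists_of_transversal σ π ρ (hπ i) (hπ' i) (hρ i) hσ hσ' (Y i)
      exact ⟨fun i => ⟨y i, (hmem i _).mpr (hy i)⟩, funext fun i => funext (hy' i)⟩
  have hV : Function.Injective V := by
    intro v w h
    have hv := v.2.1
    have hw := w.2.1
    rw [legs_annIdem] at hv hw
    refine Subtype.ext ((E.legs E').ext_of_transversal τ hv hw (fun s => ?_) (congrFun h))
    by_cases hs : c ((pants M N P Q).act s (E.legs E').base)
    · exact Or.inr (hτ s hs)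
    · left
      constructor
      · by_contra h0
        exact hs (of_inflate_one_mul I J hc v.2.2 h0)
      · by_contra h0
        exact hs (of_inflate_one_mul I J hc w.2.2 h0)
  have hVC : V ∘ Φ = T ∘ C := by
    funext y k
    have h := hdT (fun i => (y i).1) (fun i => (hmem i _).mp (y i).2) k
    refine Eq.trans ?_ h
    have h1 : Φ y = ∑ i, F i (y i) := by
      simp only [Φ, LinearMap.lsum_apply, LinearMap.sum_apply, LinearMap.comp_apply,
        LinearMap.proj_apply]
    have h2 : (Φ y).1 = ∑ i, (F i (y i)).1 :=
      (congrArg Subtype.val h1).trans (map_sum (pantsSubgroup I J _ _).subtype _ _)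
    exact (congrArg (fun v : Skein (pants M N P Q) => v (E.legs E').base (τ k)) h2).trans
      (Skein.sum_apply _ _ _ _)
  -- `V ∘ Φ = T ∘ C` is bijective, so `Φ` is injective; since `V` is injective, surjectivity of `V ∘
  -- Φ` passes to `Φ`. No dimension count is needed.
  have hΦ : Function.Bijective Φ := by
    have h := hT.comp hC
    rw [← hVC] at h
    refine ⟨h.1.of_comp, fun v => ?_⟩
    obtain ⟨y, hy⟩ := h.2 (V v)
    exact ⟨y, hV hy⟩
  exact ⟨((DirectSum.linearEquivFunOnFintype _ _ _).trans (LinearEquiv.ofBijective Φ hΦ)).symm⟩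

end fusion

variable {p : ℕ} [Fact p.Prime]

/-! ### The inflated identities of the three equivalences -/

section coefficients

/-- The idempotents inflating the simple objects sum to the identity of `(*, *)`, so the lower walls
of two twists impose no condition on labels. -/
theorem FF_coeff_sum (q r m : (ZMod p)ˣ) (hm : m = q⁻¹ * r) (y) (k : ZMod p) :
    ∑ a, (Inflation.FF q r m hm).coeff a y 0 k 0 = if k = 0 then 1 else 0 := by
  have hp : (p : ℂ) ≠ 0 := Nat.cast_ne_zero.mpr (NeZero.ne p)
  have e : ∀ a : ZMod p, (Inflation.FF q r m hm).coeff a y 0 k 0 =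
      (1 / p : ℂ) * ZMod.stdAddChar ((q : ZMod p) * k * a) := fun a => by
    simp only [Inflation.FF]
    congr 2
    ring
  refine (Finset.sum_congr rfl fun a _ => e a).trans ?_
  rw [← Finset.mul_sum, Inflation.sum_char]
  have : (q : ZMod p) * k = 0 ↔ k = 0 := Units.mul_right_eq_zero q
  by_cases hk : k = 0
  · simp [hk, hp]
  · simp [hk]

/-- Only the pairs `(a, 0)` are inflated objects, which is why the waist forces the second label to
vanish. -/
theorem XX_coeff_sum (k l m : (ZMod p)ˣ) (hm : m = k * l) (y : ZMod p × ZMod p) (j : ZMod p) :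
    ∑ a, (Inflation.XX k l m hm).coeff a y 0 j 0 = if y.2 = 0 ∧ j = 0 then 1 else 0 := by
  simp only [Inflation.XX, mul_zero]
  refine (Finset.sum_eq_single y.1 (fun b _ hb => ?_) (by simp)).trans ?_
  · rw [if_neg]
    exact fun h => hb h.1.symm
  · simp

theorem FX_coeff_sum (q l m : (ZMod p)ˣ) (hm : m = q * l) (y : Unit × ZMod p) (j : ZMod p) :
    ∑ a, (Inflation.FX q l m hm).coeff a y 0 j 0 = if y.2 = 0 ∧ j = 0 then 1 else 0 := by
  simp [Inflation.FX]

theorem inflate_FF_XX_one_support {q s m l n m' : (ZMod p)ˣ} (hm : m = q⁻¹ * s)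
    (hm' : m' = l * n) (x : (pants (Wall.F q) (Wall.F s) (Wall.X l) (Wall.X n)).Lab)
    (k : Fin 5 → ZMod p)
    (h : inflate (Inflation.FF q s m hm) (Inflation.XX l n m' hm') 1 x k ≠ 0) :
    k = 0 ∧ x.2.2.2 = (0 : ZMod p) := by
  rw [inflate_one_apply, FF_coeff_sum, XX_coeff_sum] at h
  split_ifs at h with h1 h2 h3 <;> simp at h
  refine ⟨?_, h3.1⟩
  funext i
  fin_cases i
  · exact h1.1
  · exact h2
  · simpa [h2] using h3.2
  · simpa [h2] using h1.2.2
  · exact h1.2.1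

theorem inflate_FX_XX_one_support {q s m l n m' : (ZMod p)ˣ} (hm : m = q * s)
    (hm' : m' = l * n) (x : (pants (Wall.F q) (Wall.X s) (Wall.X l) (Wall.X n)).Lab)
    (k : Fin 5 → ZMod p)
    (h : inflate (Inflation.FX q s m hm) (Inflation.XX l n m' hm') 1 x k ≠ 0) :
    k = 0 ∧ x.2.1 = (0 : ZMod p) ∧ x.2.2.2 = (0 : ZMod p) := by
  rw [inflate_one_apply, FX_coeff_sum, XX_coeff_sum] at h
  split_ifs at h with h1 h2 h3 <;> simp at h
  refine ⟨?_, h2.1, h3.1⟩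
  funext i
  fin_cases i
  · exact h1.1
  · exact h2.2
  · simpa [h2.2] using h3.2
  · simpa [h2.2] using h1.2.2
  · exact h1.2.1

end coefficients

/-! ### Fusion of two twists -/

section twists

/-- Normal forms of the strings on a pair of pants whose legs absorb two twists. -/
def twistStr (k : ZMod p × ZMod p) : Fin 5 → ZMod p := ![k.1, 0, -k.2, k.2, 0]

/-- The leg strings `-t 1` and `-t 4` account for the second and fifth components; the vanishing
outer label on `X_n` then determines `t 2`. -/
theorem exists_twistStr (q l s n : (ZMod p)ˣ) (x z : ZMod p) (t : Fin 5 → ZMod p)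
    (ht : ((pants (Wall.F q) (Wall.F s) (Wall.X l) (Wall.X n)).act t
      ((charFX q l x).legs (charFX s n z)).base).2.2.2 = (0 : ZMod p)) :
    ∃ k h, t = twistStr k + ((charFX q l x).legs (charFX s n z)).hom h := by
  have ht' : t 3 + t 2 + n * t 4 = 0 := by
    simpa [TwistedCharacter.legs, charFX] using ht
  refine ⟨(t 0 + l * t 1, t 3 + n * t 4), (-t 1, -t 4), ?_⟩
  funext i
  fin_cases i <;> simp [twistStr, TwistedCharacter.legs, charFX]
  linear_combination ht'

/-- The matrix of the gluing map, without any relation between `m` and `m'`, so that it serves both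
the degenerate and the generic case. The fixed diagram moves the label of `X_l` from `0` to `l δ =
β` and leaves that of `X_n` at `0`, giving the inflation of `β`. -/
theorem twist_fusion_apply {q l s n m m' : (ZMod p)ˣ} (hm : m = q⁻¹ * s) (hm' : m' = l * n)
    (x z δ : ZMod p) {β : ZMod p} (hβ : (l : ZMod p) * δ = β) {y : Ann (Wall.X m) (Wall.X m')}
    (hy : ∀ a t, a ≠ ((0 : ZMod p), β) → y a t = 0) (k : ZMod p × ZMod p) :
    (inflate (Inflation.FF q s m hm) (Inflation.XX l n m' hm') y *
      (diagram ((charFX q l x).legs (charFX s n z)).base ![0, 0, -δ, δ, 0] *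
        ((charFX q l x).legs (charFX s n z)).idem)) ((charFX q l x).legs (charFX s n z)).base
      (twistStr k) = ((p : ℂ)⁻¹ * (p : ℂ)⁻¹ * (p : ℂ)⁻¹) *
      ∑ h, Theta x (-(q * l)) (δ - k.2 + n * h) * Theta z (-(s * n)) h *
        ZMod.stdAddChar (-(s * (k.2 - n * h) * h) : ZMod p) *
        y ((0 : ZMod p), β) (k.1 - (l : ZMod p) * (δ - k.2 + n * h), h) := by
  subst hβ
  rw [inflate_mul_diagram_mul_idem_apply, Fintype.sum_prod_type_right, Fintype.card_prod,
    ZMod.card, Finset.mul_sum, Finset.mul_sum]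
  refine Finset.sum_congr rfl fun h _ => ?_
  have e1 : ∀ g, twistStr k - ((charFX q l x).legs (charFX s n z)).hom (g, h) =
      ![k.1 - l * g, g, -k.2, k.2 - n * h, h] := by
    intro g
    funext i
    fin_cases i <;> simp [twistStr, TwistedCharacter.legs, charFX]
  have e2 : ∀ g, ![k.1 - l * g, g, -k.2, k.2 - n * h, h] - ![0, 0, -δ, δ, 0] =
      ![k.1 - l * g, g, -k.2 + δ, k.2 - n * h - δ, h] := by
    intro g
    funext i
    fin_cases i <;> simp
  -- Inflated diagrams satisfy `k 1 + k 3 = 0`, which leaves one left-leg string `g` for each `h`.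
  rw [Finset.sum_eq_single (δ - k.2 + n * h)]
  · rw [e1, e2, inflate_apply_of_support (R := Wall.X m) (S := Wall.X m') _ _ hy]
    simp [TwistedCharacter.legs, charFX, Inflation.FF, Inflation.XX]
    rw [if_pos (by ring), if_pos (by ring)]
    -- The crossing on `F_q` cancels the phase of the idempotent inflating `0`.
    have e3 : ∀ A : ZMod p, (ZMod.stdAddChar (q * A * (-(n * h) + (k.2 - δ)) +
        -(s * (k.2 - n * h) * h) : ZMod p) : ℂ) *
        ZMod.stdAddChar (q * A * (δ - k.2 + n * h) : ZMod p) =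
        ZMod.stdAddChar (-(s * (k.2 - n * h) * h) : ZMod p) := by
      intro A
      rw [← AddChar.map_add_eq_mul]
      congr 1
      ring
    rw [← e3 (k.1 - (l : ZMod p) * (δ - k.2 + n * h))]
    ring
  · intro g _ hg
    rw [e1, e2, inflate_apply_of_support (R := Wall.X m) (S := Wall.X m') _ _ hy, if_neg]
    · simp
    · intro h'
      apply hg
      simp at h'
      linear_combination h'
  · simp

/-- Here `s = q l n`, so both factors have the same quadratic coefficient `-(s n) = -(q l) n ^ 2` in
`t`, and `Theta_mul_self` turns their `t`-dependence into a plain character. -/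
theorem twist_phase {q l s n : (ZMod p)ˣ} (h : q⁻¹ * s = l * n) (x z u t : ZMod p) :
    Theta x (-(q * l)) (u + n * t) * Theta z (-(s * n)) t =
      Theta x (-(q * l)) u * ZMod.stdAddChar
        ((n * x + z) * t - s * n * t ^ 2 - q * l * n * u * t : ZMod p) := by
  have hs : (s : ZMod p) = q * l * n := by
    rw [inv_mul_eq_iff_eq_mul] at h
    rw [h]
    push_cast
    ring
  have ha : -((s : ZMod p) * n) = -(q * l) * (n : ZMod p) ^ 2 := by rw [hs]; ring
  rw [Theta_add, Theta_units_mul, ← ha, mul_right_comm, mul_assoc (Theta x _ u), Theta_mul_self,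
    mul_assoc, ← AddChar.map_add_eq_mul]
  congr 2
  ring

theorem nonempty_twist_fusion_equiv_sum {q l s n m : (ZMod p)ˣ} (hm : m = q⁻¹ * s)
    (hm' : m = l * n) (x z : ZMod p) (w : ZMod p → ZMod p)
    (hw : ∀ α, w α = z + n * x - n * q * α) :
    Nonempty (Fusion (Inflation.FF q s m hm) (Inflation.XX l n m hm') (idemFX q l x)
      (idemFX s n z) ≃ₗ[Ann (Wall.X m) (Wall.X m)]
        ⨁ α : ZMod p, Defect (idemXXsame m α (w α))) := by
  obtain rfl := funext hw
  have hp : (p : ℂ) ≠ 0 := Nat.cast_ne_zero.mpr (NeZero.ne p)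
  refine nonempty_fusion_equiv _ _ (idemFX_eq q l x) (idemFX_eq s n z)
    (fun α => idemXXsame_eq m α (z + n * x - n * q * α))
    (fun g : ZMod p => (g, 0)) (fun t => t.1 + m * t.2)
    (fun t => -t.2) ?_ ?_ ?_ ?_ ?_ _ (inflate_FF_XX_one_support hm hm') twistStr
    (exists_twistStr q l s n x z)
    -- The strings `δ = l⁻¹ α` create the label `α` on `X_l`, as the base label `(0, α)` of the
    -- summand requires.
    (fun α => ![0, 0, -((l⁻¹ : (ZMod p)ˣ) * α), (l⁻¹ : (ZMod p)ˣ) * α, 0])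
    _ (bijective_shearedFourier (fun k => ((p : ℂ)⁻¹ * (p : ℂ)⁻¹) * Theta x (-(q * l)) (-k))
      (fun α => Theta x (-(q * l)) ((l⁻¹ : (ZMod p)ˣ) * α))
      (fun k => mul_ne_zero (by simp [hp]) (Theta_ne_zero _ _ _))
      (fun α => Theta_ne_zero _ _ _) q q.ne_zero l 1) ?_
  · intro i t
    simp [charXXsame]
  · intro i t h
    simp [charXXsame]
    ring
  · intro i t h
    simp [charXXsame, add_comm]
  · simp
  · simp
  · intro y hy k
    dsimp only
    rw [Finset.mul_sum]
    refine Finset.sum_congr rfl fun α _ => ?_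
    have hδ : (l : ZMod p) * ((l⁻¹ : (ZMod p)ˣ) * α) = α := by
      rw [← mul_assoc, Units.mul_inv, one_mul]
    rw [twist_fusion_apply hm hm' x z _ hδ
      (fun a t ha => (charXXsame m α (z + n * x - n * q * α)).apply_eq_zero (hy α) ha t)]
    set δ : ZMod p := (l⁻¹ : (ZMod p)ˣ) * α
    -- The term does not depend on `h`, so the sum over `h` gives `p` and cancels one factor `p⁻¹`.
    have hterm : ∀ h, Theta x (-(q * l)) (δ - k.2 + n * h) * Theta z (-(s * n)) h *
        ZMod.stdAddChar (-(s * (k.2 - n * h) * h) : ZMod p) *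
        y α ((0 : ZMod p), α) (k.1 - (l : ZMod p) * (δ - k.2 + n * h), h) =
        Theta x (-(q * l)) (-k.2) * Theta x (-(q * l)) δ * ZMod.stdAddChar (q * α * k.2 : ZMod p) *
          y α ((0 : ZMod p), α) ((k.1 + l * k.2 - 1 * α, 0) : ZMod p × ZMod p) := by
      intro h
      have hy' : y α ((0 : ZMod p), α) (k.1 - (l : ZMod p) * (δ - k.2 + n * h), h) =
          ZMod.stdAddChar (-h * (z + n * x - n * q * α) : ZMod p) *
            y α ((0 : ZMod p), α) ((k.1 + l * k.2 - 1 * α, 0) : ZMod p × ZMod p) := by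
        have h1 := (charXXsame m α (z + n * x - n * q * α)).apply_add_hom (hy α)
          ((k.1 + l * k.2 - 1 * α, 0) : ZMod p × ZMod p) (-h)
        have h2 : ((k.1 + l * k.2 - 1 * α, 0) : ZMod p × ZMod p) +
            (charXXsame m α (z + n * x - n * q * α)).hom (-h) =
            (k.1 - (l : ZMod p) * (δ - k.2 + n * h), h) := by
          ext
          · simp only [charXXsame, AddMonoidHom.mk'_apply, Prod.fst_add, hm', Units.val_mul]
            linear_combination hδ
          · simp [charXXsame]
        rw [h2] at h1
        simpa [charXXsame] using h1
      have hs : (s : ZMod p) = q * l * n := by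
        rw [eq_inv_mul_iff_mul_eq] at hm
        rw [← hm, hm']
        push_cast
        ring
      -- The squares of `h` cancel, and the remaining linear phase is removed by the character `z +
      -- n x - n q α` of the summand; what survives is the Fourier kernel `q α k.2`.
      have e : (ZMod.stdAddChar (-(q * l) * δ * -k.2 : ZMod p) : ℂ) * ZMod.stdAddChar
          ((n * x + z) * h - s * n * h ^ 2 - q * l * n * (δ - k.2) * h : ZMod p) *
          ZMod.stdAddChar (-(s * (k.2 - n * h) * h) : ZMod p) *
          ZMod.stdAddChar (-h * (z + n * x - n * q * α) : ZMod p) =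
          ZMod.stdAddChar (q * α * k.2 : ZMod p) := by
        simp only [← AddChar.map_add_eq_mul]
        congr 1
        linear_combination (q * k.2 - q * n * h) * hδ - (k.2 * h) * hs
      rw [twist_phase (hm.symm.trans hm'), hy', sub_eq_add_neg δ, Theta_add, ← e]
      ring_nf
    rw [Finset.sum_congr rfl fun h _ => hterm h]
    simp only [Finset.sum_const, Finset.card_univ, ZMod.card, nsmul_eq_mul]
    simp [charXXsame]
    field_simp

theorem nonempty_twist_fusion_equiv {q l s n m m' : (ZMod p)ˣ} (hm : m = q⁻¹ * s)
    (hm' : m' = l * n) (h : m ≠ m') (x z : ZMod p) :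
    Nonempty (Fusion (Inflation.FF q s m hm) (Inflation.XX l n m' hm') (idemFX q l x)
      (idemFX s n z) ≃ₗ[Ann (Wall.X m) (Wall.X m')] Defect (idemXX m m')) := by
  have hp : (p : ℂ) ≠ 0 := Nat.cast_ne_zero.mpr (NeZero.ne p)
  -- The Fourier frequency, nonzero exactly because the walls differ.
  have hc : (q : ZMod p) * l * n - s ≠ 0 := by
    intro h0
    apply h
    rw [hm, hm', inv_mul_eq_iff_eq_mul]
    ext
    push_cast
    linear_combination -h0
  have hF := bijective_shearedFourier
    (fun k => ((p : ℂ)⁻¹ * (p : ℂ)⁻¹ * (p : ℂ)⁻¹) * Theta x (-(q * l)) (-k))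
    (fun h => Theta x (-(q * l)) (n * h) * Theta z (-(s * n)) h *
      ZMod.stdAddChar (s * n * h ^ 2 : ZMod p))
    (fun k => mul_ne_zero (by simp [hp]) (Theta_ne_zero _ _ _))
    (fun h => mul_ne_zero (mul_ne_zero (Theta_ne_zero _ _ _) (Theta_ne_zero _ _ _))
      (stdAddChar_ne_zero _)) _ hc l ((l : ZMod p) * n)
  have hcurry : Function.Bijective fun (Y : Unit → ZMod p × ZMod p → ℂ) (h g : ZMod p) =>
      Y () (g, h) :=
    ⟨fun Y Z hYZ => funext fun _ => funext fun t => congrFun (congrFun hYZ t.2) t.1,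
      fun Y => ⟨fun _ t => Y t.2 t.1, rfl⟩⟩
  have hmain : Nonempty (Fusion (Inflation.FF q s m hm) (Inflation.XX l n m' hm') (idemFX q l x)
      (idemFX s n z) ≃ₗ[Ann (Wall.X m) (Wall.X m')] ⨁ _ : Unit, Defect (idemXX m m')) := by
    refine nonempty_fusion_equiv _ _ (idemFX_eq q l x) (idemFX_eq s n z) (fun _ => idemXX_eq m m')
      id id (fun _ => ()) ?_ ?_ ?_ ?_ ?_
      _ (inflate_FF_XX_one_support hm hm') twistStr (exists_twistStr q l s n x z)
      -- No string is needed, the base label being `(0, 0)`; `-0` matches `twist_fusion_apply` at `δ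
      -- = 0`.
      (fun _ => ![0, 0, -0, 0, 0]) _ (hF.comp hcurry) ?_
    · simp [charXX]
    · simp [charXX]
    · simp
    · simp
    · simp
    · intro y hy k
      rw [Fintype.sum_unique, twist_fusion_apply hm hm' x z 0 (mul_zero _)
        (fun a t ha => (charXX m m').apply_eq_zero (hy ()) ha t)]
      simp only [Function.comp_apply]
      rw [mul_assoc _ (Theta _ _ _)]
      congr 1
      rw [Finset.mul_sum]
      refine Finset.sum_congr rfl fun h _ => ?_
      -- The square of `h` goes into the invertible factor `B`; the term bilinear in `h` and `k.2`
      -- is the Fourier kernel.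
      have e : (ZMod.stdAddChar (-(q * l) * -k.2 * (n * h) : ZMod p) : ℂ) *
          ZMod.stdAddChar (-(s * (k.2 - n * h) * h) : ZMod p) =
          ZMod.stdAddChar (s * n * h ^ 2 : ZMod p) *
            ZMod.stdAddChar ((q * l * n - s) * h * k.2 : ZMod p) := by
        simp only [← AddChar.map_add_eq_mul]
        congr 1
        ring
      have hg : k.1 - (l : ZMod p) * (0 - k.2 + n * h) = k.1 + l * k.2 - l * n * h := by ring
      rw [hg, zero_sub, Theta_add]
      change _ = _ * (_ * y () ((0 : ZMod p), (0 : ZMod p))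
        ((k.1 + l * k.2 - l * n * h, h) : ZMod p × ZMod p))
      linear_combination (Theta x (-(q * l)) (-k.2) * Theta x (-(q * l)) (n * h) *
        Theta z (-(s * n)) h * y () ((0 : ZMod p), (0 : ZMod p))
          (k.1 + l * k.2 - l * n * h, h)) * e
  exact hmain.map fun Φ => Φ.trans (DirectSum.lid _ _ _)

end twists

/-! ### Fusion of a twist with an anyon -/

section anyons

/-- Normal forms of the strings on a pair of pants whose legs absorb a twist and an anyon. -/
def anyonStr (c k : ZMod p) : Fin 5 → ZMod p := ![k, 0, -c, 0, 0]

theorem exists_anyonStr (q l m : (ZMod p)ˣ) (x c z : ZMod p) (t : Fin 5 → ZMod p)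
    (ht : ((pants (Wall.F q) (Wall.X m) (Wall.X l) (Wall.X m)).act t
        ((charFX q l x).legs (charXXsame m c z)).base).2.1 = (0 : ZMod p) ∧
      ((pants (Wall.F q) (Wall.X m) (Wall.X l) (Wall.X m)).act t
        ((charFX q l x).legs (charXXsame m c z)).base).2.2.2 = (0 : ZMod p)) :
    ∃ k h, t = anyonStr c k + ((charFX q l x).legs (charXXsame m c z)).hom h := by
  have h1 : t 3 + m * t 4 = 0 := by
    simpa [TwistedCharacter.legs, charFX, charXXsame] using ht.1
  have h2 : c + (t 3 + t 2) + m * t 4 = 0 := by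
    simpa [TwistedCharacter.legs, charFX, charXXsame] using ht.2
  refine ⟨t 0 + l * t 1, (-t 1, -t 4), ?_⟩
  funext i
  fin_cases i <;> simp [anyonStr, TwistedCharacter.legs, charFX, charXXsame]
  · linear_combination h2 - h1
  · linear_combination h1

/-- The string `-c` between the upper walls brings the anyon label `c` on the right one to `0`,
shifting the label on `X_l` by `l c`; the left string `-(l c)` compensates. All outer labels are
then `0`. -/
theorem anyon_fusion_apply {q l m r r' : (ZMod p)ˣ} (hr : r = q * m) (hr' : r' = l * m)
    (x c z : ZMod p) {y : Ann (Wall.F r) (Wall.X r')}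
    (hy : ∀ a t, a ≠ ((), (0 : ZMod p)) → y a t = 0) (k : ZMod p) :
    (inflate (Inflation.FX q m r hr) (Inflation.XX l m r' hr') y *
      (diagram ((charFX q l x).legs (charXXsame m c z)).base ![-(l * c), 0, -c, 0, 0] *
        ((charFX q l x).legs (charXXsame m c z)).idem))
      ((charFX q l x).legs (charXXsame m c z)).base (anyonStr c k) = ((p : ℂ)⁻¹ * (p : ℂ)⁻¹) *
      ∑ h, Theta x (-(q * l)) (m * h) * ZMod.stdAddChar (h * z) *
        ZMod.stdAddChar (-(q * (k - l * (m * h)) * (m * h)) : ZMod p) *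
        y ((), (0 : ZMod p)) ((k + l * c - l * (m * h), h) : ZMod p × ZMod p) := by
  rw [inflate_mul_diagram_mul_idem_apply, Fintype.sum_prod_type_right, Fintype.card_prod,
    ZMod.card, Finset.mul_sum, Finset.mul_sum]
  refine Finset.sum_congr rfl fun h _ => ?_
  have e1 : ∀ g, anyonStr c k - ((charFX q l x).legs (charXXsame m c z)).hom (g, h) =
      ![k - l * g, g, -c, -(m * h), h] := by
    intro g
    funext i
    fin_cases i <;> simp [anyonStr, TwistedCharacter.legs, charFX, charXXsame]
  have e2 : ∀ g, ![k - l * g, g, -c, -(m * h), h] - ![-(l * c), 0, -c, 0, 0] =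
      ![k + l * c - l * g, g, 0, -(m * h), h] := by
    intro g
    funext i
    fin_cases i <;> simp
    ring
  rw [Finset.sum_eq_single (m * h : ZMod p)]
  · rw [e1, e2, inflate_apply_of_support (R := Wall.F r) (S := Wall.X r') _ _ hy]
    simp [TwistedCharacter.legs, charFX, charXXsame, Inflation.FX, Inflation.XX]
  · intro g _ hg
    rw [e1, e2, inflate_apply_of_support (R := Wall.F r) (S := Wall.X r') _ _ hy, if_neg]
    · simp
    · intro h'
      apply hg
      simp at h'
      linear_combination h'
  · simp

theorem anyon_phase (q l m : (ZMod p)ˣ) (x y h : ZMod p) :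
    Theta x (-(q * l)) (m * h) * Theta (y + m * x : ZMod p) (-(q * m * (l * m))) (-h) =
      ZMod.stdAddChar (-y * h - q * l * m ^ 2 * h ^ 2 : ZMod p) := by
  have ha : -((q : ZMod p) * m * (l * m)) = -(q * l) * (m : ZMod p) ^ 2 := by ring
  rw [Theta_units_mul, ha, add_comm y, Theta_add_left, ← mul_assoc, Theta_mul_neg,
    ← AddChar.map_add_eq_mul]
  congr 1
  ring

theorem nonempty_anyon_fusion_equiv {q l m r r' : (ZMod p)ˣ} (hr : r = q * m) (hr' : r' = l * m)
    (x c z : ZMod p) :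
    Nonempty (Fusion (Inflation.FX q m r hr) (Inflation.XX l m r' hr') (idemFX q l x)
      (idemXXsame m c z) ≃ₗ[Ann (Wall.F r) (Wall.X r')]
        Defect (idemFX r r' (z + m * (x + q * l * c)))) := by
  have hp : (p : ℂ) ≠ 0 := Nat.cast_ne_zero.mpr (NeZero.ne p)
  -- The shift by `l c` comes from the left string of the fixed diagram.
  have hT : Function.Bijective fun (Y : Unit → ZMod p → ℂ) (k : ZMod p) =>
      (p : ℂ)⁻¹ * Y () (k + l * c) := by
    refine ⟨fun Y Z hYZ => funext fun _ => funext fun t => ?_, fun V =>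
      ⟨fun _ t => p * V (t - l * c), funext fun k => ?_⟩⟩
    · have h := congrFun hYZ (t - l * c)
      simpa [hp] using h
    · simp [hp]
  set X : ZMod p := z + m * (x + q * l * c) with hX
  have hmain : Nonempty (Fusion (Inflation.FX q m r hr) (Inflation.XX l m r' hr') (idemFX q l x)
      (idemXXsame m c z) ≃ₗ[Ann (Wall.F r) (Wall.X r')] ⨁ _ : Unit, Defect (idemFX r r' X)) := by
    refine nonempty_fusion_equiv _ _ (idemFX_eq q l x) (idemXXsame_eq m c z)
      (fun _ => idemFX_eq r r' X) (fun g : ZMod p => (g, 0)) (fun t => t.1 + r' * t.2)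
      (fun t => -t.2) ?_ ?_ ?_ ?_ ?_ _ (inflate_FX_XX_one_support hr hr') (anyonStr c)
      (exists_anyonStr q l m x c z) (fun _ => ![-(l * c), 0, -c, 0, 0]) _ hT ?_
    · intro _ t
      simp [charFX]
    · intro _ t h
      simp [charFX]
      ring
    · intro _ t h
      simp [charFX, add_comm]
    · simp
    · simp
    · intro y hy k
      rw [Fintype.sum_unique, anyon_fusion_apply hr hr' x c z
        (fun a t ha => (charFX r r' X).apply_eq_zero (hy ()) ha t)]
      have hterm : ∀ h, Theta x (-(q * l)) (m * h) * ZMod.stdAddChar (h * z) *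
          ZMod.stdAddChar (-(q * (k - l * (m * h)) * (m * h)) : ZMod p) *
          y () ((), (0 : ZMod p)) ((k + l * c - l * (m * h), h) : ZMod p × ZMod p) =
          y () ((), (0 : ZMod p)) ((k + l * c, 0) : ZMod p × ZMod p) := by
        intro h
        have h1 := (charFX r r' X).apply_add_hom (hy ())
          ((k + l * c, 0) : ZMod p × ZMod p) (-h)
        have h2 : ((k + l * c, 0) : ZMod p × ZMod p) + (charFX r r' X).hom (-h) =
            (k + l * c - l * (m * h), h) := by
          ext
          · simp only [charFX, AddMonoidHom.mk'_apply, Prod.fst_add, hr', Units.val_mul]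
            ring
          · simp [charFX]
        have hy' : y () ((), (0 : ZMod p)) ((k + l * c - l * (m * h), h) : ZMod p × ZMod p) =
            Theta (z + m * (q * l * c) + m * x : ZMod p) (-(q * m * (l * m))) (-h) *
              ZMod.stdAddChar (q * m * (k + l * c) * h : ZMod p) *
              y () ((), (0 : ZMod p)) ((k + l * c, 0) : ZMod p × ZMod p) := by
          rw [h2] at h1
          have hX' : z + m * (q * l * c) + m * x = X := by rw [hX]; ring
          rw [hX']
          simpa [charFX, hr, hr'] using h1
        -- All phases in `h` cancel. The shifted left string `k + l c` crosses the right string `h`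
        -- on the wall `F_{q m}`, which produces the contribution `m q l c` to the label.
        have e : (ZMod.stdAddChar (h * z) : ℂ) *
            ZMod.stdAddChar (-(q * (k - l * (m * h)) * (m * h)) : ZMod p) *
            ZMod.stdAddChar (q * m * (k + l * c) * h : ZMod p) * ZMod.stdAddChar
              (-(z + m * (q * l * c)) * h - q * l * m ^ 2 * h ^ 2 : ZMod p) = 1 := by
          simp only [← AddChar.map_add_eq_mul]
          rw [← AddChar.map_zero_eq_one (ZMod.stdAddChar (N := p))]
          congr 1
          ring
        rw [← anyon_phase] at e
        rw [hy']
        linear_combination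
          y () ((), (0 : ZMod p)) ((k + l * c, 0) : ZMod p × ZMod p) * e
      rw [Finset.sum_congr rfl fun h _ => hterm h]
      simp only [Finset.sum_const, Finset.card_univ, ZMod.card, nsmul_eq_mul]
      rw [mul_assoc, inv_mul_cancel_left₀ hp]
      rfl
  exact hmain.map fun Φ => Φ.trans (DirectSum.lid _ _ _)

end anyons

end

/-! ### The fusion rules -/

theorem mainTheorem3 :
    (∀ (p : ℕ) [Fact p.Prime] (_ : p ≠ 2) (q l s n : (ZMod p)ˣ) (h : q⁻¹ * s = l * n)
      (x z : ZMod p),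
      Nonempty (
        Fusion (Inflation.FF q s (l * n) h.symm) (Inflation.XX l n (l * n) rfl)
            (idemFX q l x) (idemFX s n z)
          ≃ₗ[Ann (Wall.X (l * n)) (Wall.X (l * n))]
        ⨁ α : ZMod p, Defect (idemXXsame (l * n) α (z + n * x - n * q * α)))) ∧
    (∀ (p : ℕ) [Fact p.Prime] (q l s n : (ZMod p)ˣ) (_ : q⁻¹ * s ≠ l * n) (x z : ZMod p),
      Nonempty (
        Fusion (Inflation.FF q s (q⁻¹ * s) rfl) (Inflation.XX l n (l * n) rfl)
            (idemFX q l x) (idemFX s n z)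
          ≃ₗ[Ann (Wall.X (q⁻¹ * s)) (Wall.X (l * n))]
        Defect (idemXX (q⁻¹ * s) (l * n)))) ∧
    (∀ (p : ℕ) [Fact p.Prime] (q l m : (ZMod p)ˣ) (x c z : ZMod p),
      Nonempty (
        Fusion (Inflation.FX q m (q * m) rfl) (Inflation.XX l m (l * m) rfl)
            (idemFX q l x) (idemXXsame m c z)
          ≃ₗ[Ann (Wall.F (q * m)) (Wall.X (l * m))]
        Defect (idemFX (q * m) (l * m) (z + m * (x + q * l * c))))) ∧
    (∀ x z : ZMod 2,
      Nonempty (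
        Fusion (Inflation.FF 1 1 1 (by simp)) (Inflation.XX 1 1 1 (by simp))
            (sigmaTwist x) (sigmaTwist z)
          ≃ₗ[Ann (Wall.X (1 : (ZMod 2)ˣ)) (Wall.X (1 : (ZMod 2)ˣ))]
        ⨁ j : ZMod 2, Defect (anyonEM (j + x + z) j))) ∧
    (∀ x c z : ZMod 2,
      Nonempty (
        Fusion (Inflation.FX 1 1 1 (by simp)) (Inflation.XX 1 1 1 (by simp))
            (sigmaTwist x) (anyonEM z c)
          ≃ₗ[Ann (Wall.F (1 : (ZMod 2)ˣ)) (Wall.X (1 : (ZMod 2)ˣ))]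
        Defect (sigmaTwist (x + z + c)))) := by
  refine ⟨fun p _ _ q l s n h x z =>
      nonempty_twist_fusion_equiv_sum h.symm rfl x z _ fun _ => rfl,
    fun p _ q l s n h x z => nonempty_twist_fusion_equiv rfl rfl h x z,
    fun p _ q l m x c z => nonempty_anyon_fusion_equiv rfl rfl x c z,
    fun x z => nonempty_twist_fusion_equiv_sum (by simp) (by simp) x z (fun j => j + x + z)
      fun j => ?_, fun x c z => ?_⟩
  -- Over `ℤ/2` the units here are `1` and signs disappear, so `z + n x - n q α` becomes `j + x +
  -- z`.
  · rw [CharTwo.sub_eq_add]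
    push_cast
    ring
  · have h := nonempty_anyon_fusion_equiv (q := (1 : (ZMod 2)ˣ)) (l := 1) (m := 1) (r := 1)
      (r' := 1) (by simp) (by simp) x c z
    have hx : z + ((1 : (ZMod 2)ˣ) : ZMod 2) * (x + ((1 : (ZMod 2)ˣ) : ZMod 2) *
        ((1 : (ZMod 2)ˣ) : ZMod 2) * c) = x + z + c := by
      push_cast
      ring
    rw [hx] at h
    exact h
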